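/- **Setting.** Let $\Delta x,\Delta y,R>0$, $\mathcal N_G\in\{1,2,\dots\}$ (grid spacings, communication range, devices per gateway), $\eta>2$ (path-loss exponent), $P>0$ (constant transmit power), $\sigma^2\ge 0$ (noise power), $r_o>0$ (distance of the intended device), $\phi_0\in\mathbb R$ (its direction), $0\le b\le 1$, $n\in\mathbb N$, and let $G(\theta)=1+b\cos(n\theta)$ be the antenna gain. A packet of $L>0$ bits is sent in $m\ge1$ segments, one per slot of length $T_s>0$, at rate $\mathcal R_m=L/(mT_s)=\zeta W\log_2(1+\Xi_m)$ with $\zeta,W>0$; that is, the SINR threshold is $\Xi_m=2^{L/(m\zeta WT_s)}-1$. The test gateway is at the origin of $\mathbb R^2$. The active devices of the other cells form a homogeneous Poisson point process $\{v_j\}$ on $\mathbb R^2$ with intensity $\lambda=\frac{1}{\Delta x\,\Delta y\,\mathcal N_G}$; only those with $\|v_j\|\ge \sqrt3R/2$ interfere. Conditionally on all locations, the orientations $\theta_j$ of the devices relative to the test gateway are independent, $\theta_j$ being uniform on $[\pi/2,3\pi/2]$ if $\|v_j\|\le\sqrt3R$ and uniform on $[0,2\pi]$ if $\|v_j\|>\sqrt3R$.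 The fading gains $h_o,h_1,h_2,\dots$ are i.i.d. exponential with mean $1$ and independent of the locations and orientations. The gateway antenna points in direction $\phi_0$, towards the intended device, whose antenna is perfectly aligned with it, so that $$\mathrm{SINR}=\frac{P\,h_o\,G(0)^2\,r_o^{-\eta}}{\sigma^2+\sum_{j:\,\|v_j\|\ge\sqrt3R/2}P\,h_j\,G(\theta_j)\,G(\arg v_j-\phi_0)\,\|v_j\|^{-\eta}} .$$ **Theorem.** Write $F(x)={}_2F_1\big(1,1-\tfrac2\eta;2-\tfrac2\eta;x\big)$ for the Gauss hypergeometric function, analytically continued to $x<1$, and $g_0=G(0)^2=(1+b)^2$. Then the segment success probability $p_m=\mathbb P\{\mathrm{SINR}>\Xi_m\}$ equals $$p_m=\exp\Bigg\{-\frac{\Xi_m r_o^\eta\sigma^2}{g_0P}-\int_0^{2\pi}\frac{\Xi_m r_o^\eta\,G(\theta_1)\,(\sqrt3R)^{2-\eta}}{4g_0\pi(\eta-2)\,\Delta x\,\Delta y\,\mathcal N_G}\Bigg[\int_0^{2\pi}2G(\theta_2)\,F\Big(\tfrac{-\Xi_m r_o^\eta G(\theta_2)G(\theta_1)}{g_0(\sqrt3R)^\eta}\Big)d\theta_2$$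 $$\qquad+\int_{\pi/2}^{3\pi/2}G(\theta_2)\Big(2^\eta F\Big(\tfrac{-\Xi_m r_o^\eta G(\theta_2)G(\theta_1)}{g_0(\sqrt3R/2)^\eta}\Big)-4F\Big(\tfrac{-\Xi_m r_o^\eta G(\theta_2)G(\theta_1)}{g_0(\sqrt3R)^\eta}\Big)\Big)d\theta_2\Bigg]d\theta_1\Bigg\}.$$ In particular, for $b=1$ (so that the intended link has gain $G(0)^2=4$) the formula holds with $g_0=4$. -/

import Mathlib

open MeasureTheory ProbabilityTheory Real Set
open scoped ENNReal NNReal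

noncomputable section

namespace IoTUplink

/-! ### The Gauss hypergeometric function on `(-∞, 1)` -/

/-- `f` continues the Gauss hypergeometric series `∑ (a)ₖ (b)ₖ / ((c)ₖ k!) xᵏ` real-analytically
from `(-1, 1)` to `(-∞, 1)`. (Mathlib's `₂F₁` is the sum of the series, hence meaningful only for
`|x| < 1`.) -/
def IsGaussContinuation (a b c : ℝ) (f : ℝ → ℝ) : Prop :=
  AnalyticOnNhd ℝ f (Iio 1) ∧ ∀ x ∈ Ioo (-1 : ℝ) 1, f x = ₂F₁ a b c x

open Classical in
/-- The Gauss hypergeometric function `₂F₁(a, b; c; x)` for real `x < 1`: the analytic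
continuation of the Gauss series. It is unique on `(-∞, 1)` by the identity theorem. -/
def gauss2F1 (a b c x : ℝ) : ℝ :=
  if h : ∃ f, IsGaussContinuation a b c f then h.choose x else 0

/-! ### Poisson point processes and independent markings -/

/-- The number (in `[0, ∞]`) of points of the enumerated point process `v` in the set `A`. -/
def pointCount {Ω E : Type*} (v : ℕ → Ω → E) (A : Set E) (ω : Ω) : ℝ≥0∞ :=
  ∑' j, A.indicator (fun _ => (1 : ℝ≥0∞)) (v j ω)

/-- The points `v 0, v 1, …` form a Poisson point process with intensity measure `Λ`: the number of
points in a set of finite intensity `Λ A` is Poisson distributed with mean `Λ A`, and the numbers of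
points in finitely many pairwise disjoint sets are independent. -/
structure IsPoissonPointProcess {Ω E : Type*} [MeasurableSpace Ω] [MeasurableSpace E]
    (v : ℕ → Ω → E) (Λ : Measure E) (μ : Measure Ω) : Prop where
  measurable : ∀ j, Measurable (v j)
  law_count : ∀ A : Set E, MeasurableSet A → Λ A ≠ ∞ →
    HasLaw (pointCount v A)
      ((poissonMeasure (Λ A).toNNReal).map (fun k : ℕ => (k : ℝ≥0∞))) μ
  indep_count : ∀ (k : ℕ) (A : Fin k → Set E), (∀ i, MeasurableSet (A i)) →
    Pairwise (fun i i' => Disjoint (A i) (A i')) →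
    iIndepFun (fun i => pointCount v (A i)) μ

/-- Conditionally on all the points `v`, the marks `θ j` are independent and `θ j` has the
distribution `κ (v j)`. -/
structure IsIndependentMarking {Ω E M : Type*} [MeasurableSpace Ω] [MeasurableSpace E]
    [MeasurableSpace M] (v : ℕ → Ω → E) (θ : ℕ → Ω → M) (κ : E → Measure M) (μ : Measure Ω) :
    Prop where
  measurable : ∀ j, Measurable (θ j)
  cond_law : ∀ (J : Finset ℕ) (C : Set (ℕ → E)) (B : ℕ → Set M),
    MeasurableSet C → (∀ j, MeasurableSet (B j)) →
    μ {ω | (fun j => v j ω) ∈ C ∧ ∀ j ∈ J, θ j ω ∈ B j} =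
      ∫⁻ ω in {ω | (fun j => v j ω) ∈ C}, ∏ j ∈ J, κ (v j ω) (B j) ∂μ

/-! ### The network -/

/-- Antenna gain `G(θ) = 1 + b cos(nθ)`. -/
def gain (b : ℝ) (n : ℕ) (θ : ℝ) : ℝ := 1 + b * cos (n * θ)

/-- Transmission rate when a packet of `L` bits is cut into `m` segments, each sent in one slot of
length `Ts`. -/
def txRate (L : ℝ) (m : ℕ) (Ts : ℝ) : ℝ := L / (m * Ts)

/-- The SINR threshold `Ξ` at rate `rate`, i.e. the solution of `rate = ζ W log₂ (1 + Ξ)`. -/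
def sinrThreshold (ζ W rate : ℝ) : ℝ := 2 ^ (rate / (ζ * W)) - 1

/-- Intensity of active devices per unit area. -/
def activeDensity (Δx Δy : ℝ) (NG : ℕ) : ℝ := 1 / (Δx * Δy * NG)

/-- Distribution of the antenna orientation (relative to the direction of the test gateway at `0`)
of an interfering device located at `z`. -/
def orientationLaw (R : ℝ) (z : ℂ) : Measure ℝ :=
  if ‖z‖ ≤ √3 * R then cond volume (Icc (π / 2) (3 * π / 2)) else cond volume (Icc 0 (2 * π))

/-- The random input of the two-dimensional Poisson model. The plane is `ℂ`, the test gateway is at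
`0`, and `v j`, `θ j`, `h j` are the location, the orientation and the fading gain of the `j`-th
active device; `h₀` is the fading gain of the intended link. -/
structure IsPoissonModel {Ω : Type*} [MeasurableSpace Ω] (μ : Measure Ω) (lam R : ℝ)
    (v : ℕ → Ω → ℂ) (θ h : ℕ → Ω → ℝ) (h₀ : Ω → ℝ) : Prop where
  locations : IsPoissonPointProcess v (ENNReal.ofReal lam • (volume : Measure ℂ)) μ
  orientations : IsIndependentMarking v θ (orientationLaw R) μ
  measurable_fading : ∀ j, Measurable (h j)
  law_fading : ∀ j, HasLaw (h j) (expMeasure 1) μ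
  indep_fading : iIndepFun h μ
  indep_fading_devices : IndepFun (fun ω j => h j ω)
    (fun ω => ((fun j => v j ω : ℕ → ℂ), (fun j => θ j ω : ℕ → ℝ))) μ
  measurable_fading₀ : Measurable h₀
  law_fading₀ : HasLaw h₀ (expMeasure 1) μ
  indep_fading₀ : IndepFun h₀
    (fun ω => ((fun j => h j ω : ℕ → ℝ), (fun j => v j ω : ℕ → ℂ), (fun j => θ j ω : ℕ → ℝ))) μ

/-- Aggregate interference power at the test gateway. Devices closer than `√3 R / 2` do not
interfere; the gateway antenna points in direction `φ₀`, so that a device at `z` is seen under the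
angle `arg z - φ₀`. -/
def interference {Ω : Type*} (P η R b : ℝ) (n : ℕ) (φ₀ : ℝ)
    (v : ℕ → Ω → ℂ) (θ h : ℕ → Ω → ℝ) (ω : Ω) : ℝ≥0∞ :=
  ∑' j, {z : ℂ | √3 * R / 2 ≤ ‖z‖}.indicator
    (fun z => ENNReal.ofReal
      (P * h j ω * gain b n (θ j ω) * gain b n (z.arg - φ₀) * ‖z‖ ^ (-η))) (v j ω)

/-- Signal to interference and noise ratio of an intended device at distance `r₀`, whose antenna
and the gateway's antenna are perfectly aligned. -/
def sinr {Ω : Type*} (P σ η R b : ℝ) (n : ℕ) (φ₀ r₀ : ℝ)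
    (v : ℕ → Ω → ℂ) (θ h : ℕ → Ω → ℝ) (h₀ : Ω → ℝ) (ω : Ω) : ℝ≥0∞ :=
  ENNReal.ofReal (P * h₀ ω * gain b n 0 * gain b n 0 * r₀ ^ (-η)) /
    (ENNReal.ofReal (σ ^ 2) + interference P η R b n φ₀ v θ h ω)

/-- The segment success probability `ℙ(SINR > Ξ)`. -/
def successProb {Ω : Type*} [MeasurableSpace Ω] (μ : Measure Ω) (Ξ P σ η R b : ℝ) (n : ℕ)
    (φ₀ r₀ : ℝ) (v : ℕ → Ω → ℂ) (θ h : ℕ → Ω → ℝ) (h₀ : Ω → ℝ) : ℝ :=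
  μ.real {ω | ENNReal.ofReal Ξ < sinr P σ η R b n φ₀ r₀ v θ h h₀ ω}

/-- The function `₂F₁(1, 1 - 2/η; 2 - 2/η; x)`. -/
def hyp (η x : ℝ) : ℝ := gauss2F1 1 (1 - 2 / η) (2 - 2 / η) x

/-- The closed form of the success probability; `g₀` is the gain product of the intended link. -/
def successFormula (g₀ Ξ P σ η R b : ℝ) (n : ℕ) (r₀ Δx Δy : ℝ) (NG : ℕ) : ℝ :=
  exp (-(Ξ * r₀ ^ η * σ ^ 2 / (g₀ * P)) -
    ∫ θ₁ in (0)..(2 * π),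
      Ξ * r₀ ^ η * gain b n θ₁ * (√3 * R) ^ (2 - η) /
          (4 * g₀ * π * (η - 2) * Δx * Δy * NG) *
        ((∫ θ₂ in (0)..(2 * π), 2 * gain b n θ₂ *
            hyp η (-(Ξ * r₀ ^ η * gain b n θ₂ * gain b n θ₁) / (g₀ * (√3 * R) ^ η))) +
          ∫ θ₂ in (π / 2)..(3 * π / 2), gain b n θ₂ *
            (2 ^ η * hyp η
                (-(Ξ * r₀ ^ η * gain b n θ₂ * gain b n θ₁) / (g₀ * (√3 * R / 2) ^ η)) -
              4 * hyp η
                (-(Ξ * r₀ ^ η * gain b n θ₂ * gain b n θ₁) / (g₀ * (√3 * R) ^ η)))))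

end IoTUplink

end

/-! ### An integral representation of `₂F₁(1, β; β + 1; x)` -/

namespace IoTUplink

/-! The success event says that `h₀` exceeds `s (σ² + I)`, where `I` is the interference and `s = Ξ
r₀^η / (g₀ P)`. As `h₀` is a unit exponential independent of everything else, conditioning on the
rest gives `exp (-s σ²) · E exp (-s I)` (`measure_lt_sinr`).

In the Laplace transform of `I`, fading turns each device into a factor `1 / (1 + q)`, with `q` its
scaled relative power. Averaging over the orientation turns this into a function `Φ` of the location
alone, and the generating functional of the Poisson process gives `exp (-λ ∫ (1 - Φ))`. Fading and
marks are integrated out of finite products only; the full series is reached by dominated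
convergence (`lintegral_expNeg_interference`).

In polar coordinates the remaining radial integral of `r · c r^(-η) / (1 + c r^(-η))` over `r > a`
equals `c a^(2-η) / (η-2) · F(-c / a^η)` (`integral_radial`). The exterior `r > √3 R` carries the
uniform law on the full circle; the ring between `√3 R / 2` and `√3 R` is a difference of two such
tails and carries the law on the half circle. Periodicity of the gain removes `φ₀`.

The link to `F` is an Euler integral: under `t = u^(-η)`, `eulerIntegral` is `β ∫₀¹ t^(β-1) / (1 - x
t) dt` with `β = 1 - 2/η`. It is analytic on `x < 1` and has the Gauss series near `0`, so the
identity theorem identifies it with `hyp`. -/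

theorem le_norm_one_sub_mul {ε s : ℝ} {z : ℂ} (hε : ε ≤ 1) (hz : z.re ≤ 1 - ε) (hs₀ : 0 ≤ s)
    (hs₁ : s ≤ 1) : ε ≤ ‖1 - z * s‖ := by
  refine le_trans ?_ (Complex.re_le_norm _)
  simp only [Complex.sub_re, Complex.one_re, Complex.mul_re, Complex.ofReal_re, Complex.ofReal_im,
    mul_zero, sub_zero]
  nlinarith

theorem rpow_neg_mem_Icc {η u : ℝ} (hη : 0 ≤ η) (hu : 1 ≤ u) : u ^ (-η) ∈ Icc (0 : ℝ) 1 :=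
  ⟨by positivity, rpow_le_one_of_one_le_of_nonpos hu (by linarith)⟩

theorem integrableOn_Ioi_one_rpow {η : ℝ} (hη : 2 < η) :
    IntegrableOn (fun u : ℝ => u ^ (1 - η)) (Ioi 1) :=
  integrableOn_Ioi_rpow_of_lt (by linarith) one_pos

theorem measurable_eulerIntegrand (η : ℝ) (z : ℂ) (k : ℕ) :
    Measurable fun u : ℝ => ((u ^ (1 - η) : ℝ) : ℂ) / (1 - z * (u ^ (-η) : ℝ)) ^ k := by
  fun_prop

/-- The parameter is complex so that analyticity follows from mere differentiability. Near `z` the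
denominators stay away from zero uniformly in `u`, so the derivative passes under the integral. -/
theorem differentiableAt_eulerIntegral {η : ℝ} (hη : 2 < η) {z : ℂ} (hz : z.re < 1) :
    DifferentiableAt ℂ
      (fun z : ℂ => ∫ u in Ioi (1 : ℝ), ((u ^ (1 - η) : ℝ) : ℂ) / (1 - z * (u ^ (-η) : ℝ))) z := by
  -- With `ε` at most half the distance from `z` to the line `Re = 1`, an open half-plane around `z`
  -- has all denominators of norm at least `ε`.
  obtain ⟨ε, hε₀, hε₁, hzε⟩ : ∃ ε : ℝ, 0 < ε ∧ ε ≤ 1 ∧ z.re < 1 - ε := by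
    refine ⟨min ((1 - z.re) / 2) 1, lt_min (by linarith) one_pos, min_le_right _ _, ?_⟩
    have := min_le_left ((1 - z.re) / 2) 1
    linarith
  have hs : {w : ℂ | w.re < 1 - ε} ∈ nhds z :=
    (isOpen_lt Complex.continuous_re continuous_const).mem_nhds hzε
  have hden : ∀ w ∈ {w : ℂ | w.re < 1 - ε}, ∀ u ∈ Ioi (1 : ℝ),
      ε ≤ ‖1 - w * (u ^ (-η) : ℝ)‖ := fun w hw u hu => by
    have := rpow_neg_mem_Icc (η := η) (by linarith) (le_of_lt hu)
    exact le_norm_one_sub_mul hε₁ (le_of_lt hw) this.1 this.2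
  have hint := integrableOn_Ioi_one_rpow hη
  have key := hasDerivAt_integral_of_dominated_loc_of_deriv_le (μ := volume.restrict (Ioi (1 : ℝ)))
    (F := fun (w : ℂ) (u : ℝ) => ((u ^ (1 - η) : ℝ) : ℂ) / (1 - w * (u ^ (-η) : ℝ)))
    (F' := fun (w : ℂ) (u : ℝ) =>
      ((u ^ (1 - η) : ℝ) : ℂ) * (u ^ (-η) : ℝ) / (1 - w * (u ^ (-η) : ℝ)) ^ 2)
    (bound := fun u => u ^ (1 - η) / ε ^ 2) (x₀ := z) hs ?_ ?_ ?_ ?_ ?_ ?_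
  · exact key.2.differentiableAt
  · refine Filter.Eventually.of_forall fun w => ?_
    simpa using (measurable_eulerIntegrand η w 1).aestronglyMeasurable
  · refine Integrable.mono' (hint.div_const ε) ?_ ?_
    · simpa using (measurable_eulerIntegrand η z 1).aestronglyMeasurable
    · filter_upwards [ae_restrict_mem measurableSet_Ioi] with u hu
      have h0 : (0 : ℝ) < u := one_pos.trans hu
      rw [norm_div, Complex.norm_real, Real.norm_of_nonneg (by positivity)]
      exact div_le_div_of_nonneg_left (by positivity) hε₀ (hden z hzε u hu)
  · exact Measurable.aestronglyMeasurable (by fun_prop)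
  · filter_upwards [ae_restrict_mem measurableSet_Ioi] with u hu w hw
    have h0 : (0 : ℝ) < u := one_pos.trans hu
    have h1 := rpow_neg_mem_Icc (η := η) (by linarith) (le_of_lt hu)
    rw [norm_div, norm_mul, norm_pow, Complex.norm_real, Complex.norm_real,
      Real.norm_of_nonneg h1.1, Real.norm_of_nonneg (by positivity)]
    have h2 := hden w hw u hu
    have h3 : (0 : ℝ) ≤ u ^ (1 - η) := by positivity
    gcongr
    nlinarith [h1.2]
  · exact hint.div_const _
  · filter_upwards [ae_restrict_mem measurableSet_Ioi] with u hu w hw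
    have h2 := hden w hw u hu
    have h3 : 1 - w * ((u ^ (-η) : ℝ) : ℂ) ≠ 0 := by
      rw [← norm_pos_iff]; linarith
    have h4 : HasDerivAt (fun w : ℂ => 1 - w * ((u ^ (-η) : ℝ) : ℂ)) (-((u ^ (-η) : ℝ) : ℂ)) w := by
      simpa using ((hasDerivAt_id w).mul_const ((u ^ (-η) : ℝ) : ℂ)).const_sub 1
    have h5 := (hasDerivAt_const w ((u ^ (1 - η) : ℝ) : ℂ)).div h4 h3
    exact h5.congr_deriv (by ring)

/-- The integral `(η - 2) ∫_{u > 1} u^(1-η) / (1 - x u^(-η)) du`. -/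
noncomputable def eulerIntegral (η x : ℝ) : ℝ :=
  (η - 2) * ∫ u in Ioi (1 : ℝ), u ^ (1 - η) / (1 - x * u ^ (-η))

theorem analyticOnNhd_eulerIntegral {η : ℝ} (hη : 2 < η) :
    AnalyticOnNhd ℝ (eulerIntegral η) (Iio 1) := by
  intro x hx
  have hopen : IsOpen {z : ℂ | z.re < 1} := isOpen_lt Complex.continuous_re continuous_const
  have hA : AnalyticAt ℂ (fun z : ℂ =>
      ∫ u in Ioi (1 : ℝ), ((u ^ (1 - η) : ℝ) : ℂ) / (1 - z * (u ^ (-η) : ℝ))) (x : ℂ) := by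
    refine DifferentiableOn.analyticAt (s := {z : ℂ | z.re < 1}) ?_ (hopen.mem_nhds ?_)
    · exact fun z hz => (differentiableAt_eulerIntegral hη hz).differentiableWithinAt
    · simpa using hx
  have hB := (analyticAt_const (v := η - 2)).mul hA.re_ofReal
  refine hB.congr (Filter.Eventually.of_forall fun y => ?_)
  have : ∀ u : ℝ, ((u ^ (1 - η) : ℝ) : ℂ) / (1 - (y : ℂ) * (u ^ (-η) : ℝ)) =
      ((u ^ (1 - η) / (1 - y * u ^ (-η)) : ℝ) : ℂ) := fun u => by push_cast; rfl
  simp only [Pi.mul_apply, eulerIntegral, this]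
  rw [integral_complex_ofReal, Complex.ofReal_re]

/-- The factor `(1)ₙ` cancels `n!`, and `(β)ₙ (β + n) = β (β + 1)ₙ` since both are `(β)ₙ₊₁`. -/
theorem gauss_coeff {β : ℝ} (hβ : 0 < β) (n : ℕ) :
    ((n.factorial : ℝ)⁻¹ * (ascPochhammer ℝ n).eval 1 * (ascPochhammer ℝ n).eval β *
      ((ascPochhammer ℝ n).eval (β + 1))⁻¹) = β / (β + n) := by
  have h1 : (ascPochhammer ℝ n).eval β * (β + n) = β * (ascPochhammer ℝ n).eval (β + 1) := by
    rw [← ascPochhammer_succ_eval, ascPochhammer_succ_left]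
    simp
  have h2 : 0 < (ascPochhammer ℝ n).eval (β + 1) := ascPochhammer_pos n _ (by linarith)
  have h3 : (n.factorial : ℝ) ≠ 0 := by positivity
  have h4 : β + n ≠ 0 := by positivity
  rw [ascPochhammer_eval_one, inv_mul_cancel₀ h3, one_mul, ← div_eq_mul_inv,
    div_eq_div_iff h2.ne' h4, h1]

/-- Since `|x u^(-η)| < 1`, the integrand is a geometric series. Its `n`-th term integrates to `xⁿ /
(η - 2 + η n)`, which `η - 2` normalises to `β / (β + n) · xⁿ`. -/
theorem eulerIntegral_eq_gauss {η : ℝ} (hη : 2 < η) {x : ℝ} (hx : x ∈ Ioo (-1 : ℝ) 1) :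
    eulerIntegral η x = ₂F₁ (1 : ℝ) (1 - 2 / η) (2 - 2 / η) x := by
  have hη0 : (0 : ℝ) < η := by linarith
  have hxabs : |x| < 1 := abs_lt.2 hx
  have hexp : ∀ n : ℕ, 1 - η - η * n < -1 := fun n => by
    have : 0 ≤ η * n := by positivity
    linarith
  have hterm : ∀ n : ℕ, ∀ u ∈ Ioi (1 : ℝ),
      u ^ (1 - η) * (x * u ^ (-η)) ^ n = x ^ n * u ^ (1 - η - η * n) := fun n u hu => by
    have h0 : (0 : ℝ) < u := one_pos.trans hu
    rw [mul_pow, ← rpow_natCast (u ^ (-η)), ← rpow_mul h0.le, mul_left_comm, ← rpow_add h0]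
    congr 2; ring
  have hval : ∀ n : ℕ, ∫ u in Ioi (1 : ℝ), x ^ n * u ^ (1 - η - η * n) =
      x ^ n * (η - 2 + η * n)⁻¹ := fun n => by
    rw [integral_const_mul, integral_Ioi_rpow_of_lt (hexp n) one_pos, one_rpow,
      ← neg_div_neg_eq, neg_neg, one_div]
    congr 2; ring
  have hsum : HasSum (fun n : ℕ => ∫ u in Ioi (1 : ℝ), x ^ n * u ^ (1 - η - η * n))
      (∫ u in Ioi (1 : ℝ), ∑' n : ℕ, x ^ n * u ^ (1 - η - η * n)) := by
    refine hasSum_integral_of_summable_integral_norm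
      (fun n => (integrableOn_Ioi_rpow_of_lt (hexp n) one_pos).const_mul _) ?_
    have h1 : ∀ n : ℕ, ∫ u in Ioi (1 : ℝ), ‖x ^ n * u ^ (1 - η - η * n)‖ =
        |x| ^ n * (η - 2 + η * n)⁻¹ := fun n => by
      have : ∀ u ∈ Ioi (1 : ℝ), ‖x ^ n * u ^ (1 - η - η * n)‖ = |x| ^ n * u ^ (1 - η - η * n) :=
        fun u hu => by
          have h0 : (0 : ℝ) < u := one_pos.trans hu
          rw [norm_mul, norm_pow, Real.norm_eq_abs, Real.norm_of_nonneg (by positivity)]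
      rw [setIntegral_congr_fun measurableSet_Ioi this, integral_const_mul,
        integral_Ioi_rpow_of_lt (hexp n) one_pos, one_rpow, ← neg_div_neg_eq, neg_neg, one_div]
      congr 2; ring
    simp only [h1]
    refine Summable.of_nonneg_of_le (fun n => ?_) (fun n => ?_)
      ((summable_geometric_of_lt_one (abs_nonneg x) hxabs).mul_right (η - 2)⁻¹)
    · have : 0 ≤ η - 2 + η * n := by have : 0 ≤ η * n := by positivity
                                     linarith
      positivity
    · have : 0 ≤ η * n := by positivity
      have h2 : 0 < η - 2 := by linarith
      gcongr
      linarith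
  have hgeom : ∀ u ∈ Ioi (1 : ℝ), ∑' n : ℕ, x ^ n * u ^ (1 - η - η * n) =
      u ^ (1 - η) / (1 - x * u ^ (-η)) := fun u hu => by
    have h1 := rpow_neg_mem_Icc hη0.le (le_of_lt hu)
    have h2 : |x * u ^ (-η)| < 1 := by
      rw [abs_mul, abs_of_nonneg h1.1]
      nlinarith [abs_nonneg x, h1.2]
    simp_rw [← hterm _ u hu]
    rw [tsum_mul_left, tsum_geometric_of_abs_lt_one h2, div_eq_mul_inv]
  rw [setIntegral_congr_fun measurableSet_Ioi hgeom] at hsum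
  have hβ : 0 < 1 - 2 / η := by rw [sub_pos, div_lt_one hη0]; exact hη
  have hcoef : ∀ n : ℕ, (η - 2) * (x ^ n * (η - 2 + η * n)⁻¹) =
      ((1 - 2 / η) / (1 - 2 / η + n)) • x ^ n := fun n => by
    have h1 : η - 2 + η * n ≠ 0 := by
      have : 0 ≤ η * n := by positivity
      have h2 : 0 < η - 2 := by linarith
      positivity
    have h2 : (1 - 2 / η + n) ≠ 0 := by positivity
    rw [smul_eq_mul, div_mul_eq_mul_div, eq_div_iff h2]
    field_simp
  have hc : (2 : ℝ) - 2 / η = 1 - 2 / η + 1 := by ring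
  rw [ordinaryHypergeometric_eq_tsum, hc]
  simp only [gauss_coeff hβ, ← hcoef]
  rw [tsum_mul_left, eulerIntegral, ← hsum.tsum_eq]
  simp only [hval]

/-- `hyp` is built from an arbitrarily chosen continuation, known explicitly only on `(-1, 1)`. Two
continuations agree near `0`, hence on the connected set `(-∞, 1)`. -/
theorem hyp_eq_eulerIntegral {η x : ℝ} (hη : 2 < η) (hx : x < 1) :
    hyp η x = eulerIntegral η x := by
  have hex : ∃ f, IsGaussContinuation 1 (1 - 2 / η) (2 - 2 / η) f :=
    ⟨eulerIntegral η, analyticOnNhd_eulerIntegral hη, fun x hx => eulerIntegral_eq_gauss hη hx⟩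
  rw [hyp, gauss2F1, dif_pos hex]
  refine hex.choose_spec.1.eqOn_of_preconnected_of_eventuallyEq (analyticOnNhd_eulerIntegral hη)
    isPreconnected_Iio (z₀ := 0) (by simp) ?_ hx
  filter_upwards [Ioo_mem_nhds (a := (-1 : ℝ)) (b := 1) (by norm_num) (by norm_num)] with y hy
  rw [hex.choose_spec.2 y hy, eulerIntegral_eq_gauss hη hy]

theorem continuousOn_hyp {η : ℝ} (hη : 2 < η) : ContinuousOn (hyp η) (Iio 1) :=
  (analyticOnNhd_eulerIntegral hη).continuousOn.congr fun _ hx => hyp_eq_eulerIntegral hη hx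

theorem integrableOn_radial {η a c : ℝ} (hη : 2 < η) (ha : 0 < a) (hc : 0 ≤ c) :
    IntegrableOn (fun r : ℝ => r * (c * r ^ (-η) / (1 + c * r ^ (-η)))) (Ioi a) := by
  have h1 : IntegrableOn (fun r : ℝ => c * r ^ (1 - η)) (Ioi a) :=
    (integrableOn_Ioi_rpow_of_lt (by linarith) ha).const_mul c
  refine Integrable.mono' h1 (Measurable.aestronglyMeasurable (by fun_prop)) ?_
  filter_upwards [ae_restrict_mem measurableSet_Ioi] with r hr
  have h0 : (0 : ℝ) < r := ha.trans hr
  rw [Real.norm_of_nonneg (by positivity), sub_eq_add_neg, rpow_add h0, rpow_one]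
  have : c * r ^ (-η) / (1 + c * r ^ (-η)) ≤ c * r ^ (-η) :=
    div_le_self (by positivity) (le_add_of_nonneg_right (by positivity))
  calc _ ≤ r * (c * r ^ (-η)) := by gcongr
    _ = _ := by ring

theorem integral_radial {η a c : ℝ} (hη : 2 < η) (ha : 0 < a) (hc : 0 ≤ c) :
    ∫ r in Ioi a, r * (c * r ^ (-η) / (1 + c * r ^ (-η))) =
      c * a ^ (2 - η) / (η - 2) * hyp η (-c / a ^ η) := by
  have hx : -c / a ^ η < 1 := lt_of_le_of_lt (div_nonpos_of_nonpos_of_nonneg (by linarith)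
    (by positivity)) one_pos
  have h2 : η - 2 ≠ 0 := by linarith
  -- The substitution `r = a u` moves the endpoint to `1` and produces the argument `-c a^(-η)`.
  have h := integral_comp_mul_left_Ioi
    (fun r : ℝ => r * (c * r ^ (-η) / (1 + c * r ^ (-η)))) 1 ha
  rw [mul_one, smul_eq_mul, eq_inv_mul_iff_mul_eq₀ ha.ne'] at h
  rw [← h, hyp_eq_eulerIntegral hη hx, eulerIntegral, ← mul_assoc, div_mul_cancel₀ _ h2,
    ← integral_const_mul, ← integral_const_mul]
  refine setIntegral_congr_fun measurableSet_Ioi fun u hu => ?_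
  have h0 : (0 : ℝ) < u := one_pos.trans hu
  have e1 : (a * u) ^ (-η) = a ^ (-η) * u ^ (-η) := mul_rpow ha.le h0.le
  have e2 : a ^ (2 - η) = a * a * a ^ (-η) := by
    rw [sub_eq_add_neg, rpow_add ha, rpow_two, sq]
  have e3 : u ^ (1 - η) = u * u ^ (-η) := by
    rw [sub_eq_add_neg, rpow_add h0, rpow_one]
  have e4 : -c / a ^ η = -(c * a ^ (-η)) := by
    rw [rpow_neg ha.le, neg_div, div_eq_mul_inv]
  simp only [e1, e2, e3, e4]
  have e5 : 1 - -(c * a ^ (-η)) * u ^ (-η) = 1 + c * (a ^ (-η) * u ^ (-η)) := by ring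
  rw [e5]
  ring

end IoTUplink

/-! ### The function `t ↦ exp (-t)` on `[0, ∞]` -/

namespace IoTUplink

/-- The function `exp (-t)` on `[0, ∞]`, with value `0` at `∞`. -/
noncomputable def expNeg (t : ℝ≥0∞) : ℝ≥0∞ := EReal.exp (-(t : EReal))

/-- Continuity includes the point `∞`, so limits of series pass through `expNeg` without first
showing that the interference is finite. -/
theorem continuous_expNeg : Continuous expNeg :=
  EReal.expHomeomorph.continuous.comp (continuous_neg.comp continuous_coe_ennreal_ereal)

@[fun_prop]
theorem measurable_expNeg : Measurable expNeg := continuous_expNeg.measurable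

theorem antitone_expNeg : Antitone expNeg := fun _ _ h =>
  EReal.exp_monotone (EReal.neg_le_neg_iff.2 (EReal.coe_ennreal_le_coe_ennreal_iff.2 h))

@[simp] theorem expNeg_zero : expNeg 0 = 1 := by simp [expNeg]

@[simp] theorem expNeg_top : expNeg ∞ = 0 := by simp [expNeg]

theorem expNeg_le_one (t : ℝ≥0∞) : expNeg t ≤ 1 := expNeg_zero ▸ antitone_expNeg (zero_le (a := t))

theorem expNeg_ofReal {x : ℝ} (hx : 0 ≤ x) :
    expNeg (ENNReal.ofReal x) = ENNReal.ofReal (exp (-x)) := by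
  rw [expNeg, EReal.coe_ennreal_ofReal, max_eq_left hx, ← EReal.coe_neg, EReal.exp_coe]

theorem expNeg_eq_ofReal {t : ℝ≥0∞} (ht : t ≠ ∞) :
    expNeg t = ENNReal.ofReal (exp (-t.toReal)) := by
  rw [← expNeg_ofReal ENNReal.toReal_nonneg, ENNReal.ofReal_toReal ht]

theorem expNeg_add (s t : ℝ≥0∞) : expNeg (s + t) = expNeg s * expNeg t := by
  simp only [expNeg, EReal.exp_neg, EReal.coe_ennreal_add, EReal.exp_add]
  refine ENNReal.mul_inv (Or.inl ?_) (Or.inr ?_) <;> simp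

theorem expNeg_sum {ι : Type*} (s : Finset ι) (f : ι → ℝ≥0∞) :
    expNeg (∑ i ∈ s, f i) = ∏ i ∈ s, expNeg (f i) := by
  classical
  induction s using Finset.induction_on with
  | empty => simp
  | insert i s hi ih => rw [Finset.sum_insert hi, Finset.prod_insert hi, expNeg_add, ih]

theorem tendsto_prod_expNeg (f : ℕ → ℝ≥0∞) :
    Filter.Tendsto (fun N => ∏ j ∈ Finset.range N, expNeg (f j)) Filter.atTop
      (nhds (expNeg (∑' j, f j))) := by
  simp only [← expNeg_sum]
  exact (continuous_expNeg.tendsto _).comp ENNReal.summable.hasSum.tendsto_sum_nat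

/-- Dominated convergence for the Laplace transform of a series. -/
theorem tendsto_lintegral_prod_expNeg {Ω : Type*} [MeasurableSpace Ω] {μ : Measure Ω}
    [IsProbabilityMeasure μ] {f : ℕ → Ω → ℝ≥0∞} (hf : ∀ j, Measurable (f j)) :
    Filter.Tendsto (fun N => ∫⁻ ω, ∏ j ∈ Finset.range N, expNeg (f j ω) ∂μ) Filter.atTop
      (nhds (∫⁻ ω, expNeg (∑' j, f j ω) ∂μ)) := by
  refine tendsto_lintegral_of_dominated_convergence (fun _ => 1)
    (fun N => Finset.measurable_prod _ fun j _ => by fun_prop)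
    (fun N => Filter.Eventually.of_forall fun ω => Finset.prod_le_one' fun j _ => expNeg_le_one _)
    (by simp) (Filter.Eventually.of_forall fun ω => tendsto_prod_expNeg _)

/-! ### The Laplace functional of a Poisson point process -/

/-- With `q = exp (-a)`, weighting the Poisson probabilities of mean `r` by `q^k` gives those of
mean `r q`, up to the factor `exp (-r (1 - q))`. -/
theorem lintegral_expNeg_poissonMeasure (r : ℝ≥0) {a : ℝ≥0∞} (ha : a ≠ ∞) :
    ∫⁻ k : ℕ, expNeg (a * k) ∂poissonMeasure r = expNeg (r * (1 - expNeg a)) := by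
  obtain ⟨q, hq⟩ : ∃ q : ℝ≥0, (q : ℝ) = exp (-a.toReal) := ⟨⟨_, (exp_pos _).le⟩, rfl⟩
  have hqa : expNeg a = q := by
    rw [expNeg_eq_ofReal ha, ← hq, ENNReal.ofReal_coe_nnreal]
  have hq1 : q ≤ 1 := by
    rw [← ENNReal.coe_le_one_iff, ← hqa]; exact expNeg_le_one a
  have h1 : ∀ k : ℕ, ENNReal.ofReal (exp (-r) * r ^ k / k.factorial) * expNeg (a * k) =
      ENNReal.ofReal (exp (-(r * (1 - q))) *
        (exp (-(r * q : ℝ≥0)) * (r * q : ℝ≥0) ^ k / k.factorial)) := fun k => by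
    have : expNeg (a * k) = ENNReal.ofReal ((q : ℝ) ^ k) := by
      rw [expNeg_eq_ofReal (ENNReal.mul_ne_top ha (ENNReal.natCast_ne_top k)), hq,
        ← exp_nat_mul, ENNReal.toReal_mul, ENNReal.toReal_natCast]
      congr 2; ring
    rw [this, ← ENNReal.ofReal_mul (by positivity)]
    congr 1
    have : exp (-(r : ℝ)) = exp (-(r * (1 - q))) * exp (-((r * q : ℝ≥0) : ℝ)) := by
      rw [← exp_add]; push_cast; congr 1; ring
    rw [this]; push_cast; rw [mul_pow]; ring
  have h2 := (hasSum_one_poissonMeasure (r * q)).mul_left (exp (-((r : ℝ) * (1 - q))))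
  rw [poissonMeasure, lintegral_sum_measure]
  simp only [lintegral_smul_measure, lintegral_dirac, smul_eq_mul, h1]
  rw [← ENNReal.ofReal_tsum_of_nonneg (fun k => by positivity) h2.summable, h2.tsum_eq, mul_one,
    hqa, ← expNeg_ofReal (mul_nonneg r.coe_nonneg (sub_nonneg.2 (NNReal.coe_le_one.2 hq1)))]
  congr 1
  rw [ENNReal.ofReal_mul r.coe_nonneg, ENNReal.ofReal_sub _ q.coe_nonneg]
  simp

variable {Ω E : Type*} [MeasurableSpace Ω] [MeasurableSpace E] {v : ℕ → Ω → E} {Λ : Measure E}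
  {μ : Measure Ω}

theorem measurable_pointCount (hv : ∀ j, Measurable (v j)) {A : Set E} (hA : MeasurableSet A) :
    Measurable (pointCount v A) :=
  Measurable.tsum fun j => (measurable_const.indicator hA).comp (hv j)

theorem IsPoissonPointProcess.lintegral_expNeg_pointCount (hv : IsPoissonPointProcess v Λ μ)
    {A : Set E} (hA : MeasurableSet A) (hΛ : Λ A ≠ ∞) {a : ℝ≥0∞} (ha : a ≠ ∞) :
    ∫⁻ ω, expNeg (a * pointCount v A ω) ∂μ = expNeg (Λ A * (1 - expNeg a)) := by
  have hm : Measurable fun t : ℝ≥0∞ => expNeg (a * t) := by fun_prop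
  rw [(hv.law_count A hA hΛ).lintegral_comp hm.aemeasurable,
    lintegral_map hm (measurable_of_countable _), lintegral_expNeg_poissonMeasure _ ha,
    ENNReal.coe_toNNReal hΛ]

theorem IsPoissonPointProcess.lintegral_expNeg_sum_pointCount (hv : IsPoissonPointProcess v Λ μ)
    {k : ℕ} {A : Fin k → Set E} (hA : ∀ i, MeasurableSet (A i))
    (hdisj : Pairwise fun i i' => Disjoint (A i) (A i')) (hΛ : ∀ i, Λ (A i) ≠ ∞)
    {a : Fin k → ℝ≥0∞} (ha : ∀ i, a i ≠ ∞) :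
    ∫⁻ ω, expNeg (∑ i, a i * pointCount v (A i) ω) ∂μ =
      expNeg (∑ i, Λ (A i) * (1 - expNeg (a i))) := by
  simp only [expNeg_sum]
  have hind : iIndepFun (fun i ω => expNeg (a i * pointCount v (A i) ω)) μ :=
    (hv.indep_count k A hA hdisj).comp (fun i t => expNeg (a i * t)) fun i => by fun_prop
  rw [lintegral_prod_eq_prod_lintegral_of_indepFun Finset.univ _ hind fun i => by
    have := measurable_pointCount hv.measurable (hA i)
    fun_prop]
  exact Finset.prod_congr rfl fun i _ => hv.lintegral_expNeg_pointCount (hA i) (hΛ i) (ha i)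

/-- A simple function cut off outside of a set, as a sum over its level sets. -/
theorem simpleFunc_indicator_eq_sum (s : SimpleFunc E ℝ≥0∞) (S : Set E) {k : ℕ}
    (e : s.range ≃ Fin k) (g : ℝ≥0∞ → ℝ≥0∞) (hg : g 0 = 0) (z : E) :
    g (S.indicator s z) =
      ∑ i, (s ⁻¹' {(e.symm i : ℝ≥0∞)} ∩ S).indicator (fun _ => g (e.symm i)) z := by
  by_cases hz : z ∈ S
  · rw [Finset.sum_eq_single (e ⟨s z, s.mem_range_self z⟩)]
    · simp [hz]
    · intro i _ hi
      refine indicator_of_notMem (fun h => hi ?_) _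
      rw [← e.symm_apply_eq]
      ext
      exact h.1.symm
    · simp
  · simp [hz, hg]

/-- The level sets of `s` inside `S` are disjoint and of finite intensity, so the series is a finite
combination of independent Poisson counts. -/
theorem IsPoissonPointProcess.lintegral_expNeg_tsum_simpleFunc (hv : IsPoissonPointProcess v Λ μ)
    (s : SimpleFunc E ℝ≥0∞) (hs : ∀ z, s z ≠ ∞) {S : Set E} (hS : MeasurableSet S)
    (hΛS : Λ S ≠ ∞) :
    ∫⁻ ω, expNeg (∑' j, S.indicator s (v j ω)) ∂μ =
      expNeg (∫⁻ z, (1 - expNeg (S.indicator s z)) ∂Λ) := by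
  obtain ⟨k, ⟨e⟩⟩ := Finite.exists_equiv_fin s.range
  have hA : ∀ i, MeasurableSet (s ⁻¹' {(e.symm i : ℝ≥0∞)} ∩ S) := fun i =>
    (s.measurableSet_fiber _).inter hS
  have hcount : ∀ ω, ∑' j, S.indicator s (v j ω) =
      ∑ i, (e.symm i : ℝ≥0∞) * pointCount v (s ⁻¹' {(e.symm i : ℝ≥0∞)} ∩ S) ω := fun ω => by
    have h1 := fun z => simpleFunc_indicator_eq_sum s S e id rfl z
    simp only [id] at h1
    simp only [h1, pointCount, ← ENNReal.tsum_mul_left]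
    rw [Summable.tsum_finsetSum fun i _ => ENNReal.summable]
    refine Finset.sum_congr rfl fun i _ => tsum_congr fun j => ?_
    by_cases hj : v j ω ∈ s ⁻¹' {(e.symm i : ℝ≥0∞)} ∩ S
    · rw [indicator_of_mem hj, indicator_of_mem hj, mul_one]
    · rw [indicator_of_notMem hj, indicator_of_notMem hj, mul_zero]
  have hint : ∫⁻ z, (1 - expNeg (S.indicator s z)) ∂Λ =
      ∑ i, Λ (s ⁻¹' {(e.symm i : ℝ≥0∞)} ∩ S) * (1 - expNeg (e.symm i)) := by
    have h1 := fun z => simpleFunc_indicator_eq_sum s S e (fun t => 1 - expNeg t) (by simp) z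
    simp only [h1]
    rw [lintegral_finsetSum _ fun i _ => measurable_const.indicator (hA i)]
    refine Finset.sum_congr rfl fun i _ => ?_
    rw [lintegral_indicator_const (hA i), mul_comm]
  simp only [hcount]
  rw [hint]
  refine hv.lintegral_expNeg_sum_pointCount hA (fun i i' hii => ?_) (fun i => ?_) (fun i => ?_)
  · refine Disjoint.mono inter_subset_left inter_subset_left ?_
    refine Disjoint.preimage _ (disjoint_singleton.2 fun h => hii ?_)
    exact e.symm.injective (Subtype.ext h)
  · exact ne_top_of_le_ne_top hΛS (measure_mono inter_subset_right)
  · obtain ⟨z, hz⟩ := SimpleFunc.mem_range.1 (e.symm i).2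
    exact hz ▸ hs z

/-- The Laplace functional of a Poisson point process. -/
theorem IsPoissonPointProcess.lintegral_expNeg_tsum [SigmaFinite Λ] [IsProbabilityMeasure μ]
    (hv : IsPoissonPointProcess v Λ μ) {f : E → ℝ≥0∞} (hf : Measurable f) :
    ∫⁻ ω, expNeg (∑' j, f (v j ω)) ∂μ = expNeg (∫⁻ z, (1 - expNeg (f z)) ∂Λ) := by
  -- Finite-valued simple approximants, cut off to sets of finite intensity, increase to `f`.
  set F : ℕ → E → ℝ≥0∞ := fun n => (spanningSets Λ n).indicator (SimpleFunc.eapprox f n) with hF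
  have hFm : ∀ n, Measurable (F n) := fun n =>
    (SimpleFunc.measurable _).indicator (measurableSet_spanningSets Λ n)
  have hFmono : ∀ z, Monotone fun n => F n z := fun z n m hnm => by
    refine indicator_le_indicator' ?_ |>.trans
      (indicator_le_indicator_of_subset (monotone_spanningSets Λ hnm) (fun _ => zero_le) z)
    exact fun _ => SimpleFunc.monotone_eapprox f hnm z
  have hFlim : ∀ z, Filter.Tendsto (fun n => F n z) Filter.atTop (nhds (f z)) := fun z => by
    refine (SimpleFunc.tendsto_eapprox hf z).congr' ?_
    filter_upwards [Filter.eventually_ge_atTop (spanningSetsIndex Λ z)] with n hn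
    exact (indicator_of_mem (monotone_spanningSets Λ hn (mem_spanningSetsIndex Λ z)) _).symm
  have hsum : ∀ ω, Filter.Tendsto (fun n => ∑' j, F n (v j ω)) Filter.atTop
      (nhds (∑' j, f (v j ω))) := fun ω => by
    -- The series is an integral against counting measure, so monotone convergence applies.
    have h := lintegral_tendsto_of_tendsto_of_monotone (μ := Measure.count)
      (f := fun n j => F n (v j ω)) (F := fun j => f (v j ω))
      (fun n => (measurable_of_countable _).aemeasurable)
      (Filter.Eventually.of_forall fun j => hFmono _)
      (Filter.Eventually.of_forall fun j => hFlim _)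
    simpa only [lintegral_count] using h
  have hL : Filter.Tendsto (fun n => ∫⁻ ω, expNeg (∑' j, F n (v j ω)) ∂μ) Filter.atTop
      (nhds (∫⁻ ω, expNeg (∑' j, f (v j ω)) ∂μ)) := by
    refine tendsto_lintegral_of_dominated_convergence (fun _ => 1) (fun n => ?_)
      (fun N => Filter.Eventually.of_forall fun ω => expNeg_le_one _)
      (by simp) (Filter.Eventually.of_forall fun ω => (continuous_expNeg.tendsto _).comp (hsum ω))
    exact measurable_expNeg.comp (Measurable.tsum fun j => (hFm n).comp (hv.measurable j))
  have hR : Filter.Tendsto (fun n => ∫⁻ z, (1 - expNeg (F n z)) ∂Λ) Filter.atTop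
      (nhds (∫⁻ z, (1 - expNeg (f z)) ∂Λ)) := by
    refine lintegral_tendsto_of_tendsto_of_monotone (fun n => ?_)
      (Filter.Eventually.of_forall fun z n m hnm => ?_)
      (Filter.Eventually.of_forall fun z => ?_)
    · have := hFm n
      exact Measurable.aemeasurable (by fun_prop)
    · exact tsub_le_tsub_left (antitone_expNeg (hFmono z hnm)) 1
    · exact ENNReal.Tendsto.sub tendsto_const_nhds ((continuous_expNeg.tendsto _).comp (hFlim z))
        (Or.inl ENNReal.one_ne_top)
  refine tendsto_nhds_unique hL (((continuous_expNeg.tendsto _).comp hR).congr fun n => ?_)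
  exact (hv.lintegral_expNeg_tsum_simpleFunc _ (fun z => (SimpleFunc.eapprox_lt_top f n z).ne)
    (measurableSet_spanningSets Λ n) (measure_spanningSets_lt_top Λ n).ne).symm

end IoTUplink

/-! ### Independent markings -/

namespace IoTUplink

section Marking

variable {Ω E M : Type*} [MeasurableSpace Ω] [MeasurableSpace E] [MeasurableSpace M]
  {v : ℕ → Ω → E} {θ : ℕ → Ω → M} {κ : Kernel E M} {μ : Measure Ω}

/-- The hypothesis `cond_law` speaks of events only. Induction on `J` replaces events by functions
one mark at a time; the marks in `K` are still tested by events, and arbitrary `K`, `C`, `B` are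
what the inductive step consumes. -/
theorem IsIndependentMarking.setLIntegral_prod [IsFiniteMeasure μ] [IsMarkovKernel κ]
    (h : IsIndependentMarking v θ κ μ)
    (hv : ∀ j, Measurable (v j)) {g : ℕ → E × M → ℝ≥0∞} (hg : ∀ j, Measurable (g j))
    (hg1 : ∀ j x, g j x ≤ 1) (J : Finset ℕ) :
    ∀ (K : Finset ℕ), Disjoint J K → ∀ (C : Set (ℕ → E)) (B : ℕ → Set M), MeasurableSet C →
    (∀ j, MeasurableSet (B j)) →
    ∫⁻ ω in {ω | (fun j => v j ω) ∈ C ∧ ∀ k ∈ K, θ k ω ∈ B k}, ∏ j ∈ J, g j (v j ω, θ j ω) ∂μ =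
      ∫⁻ ω in {ω | (fun j => v j ω) ∈ C},
        (∏ j ∈ J, ∫⁻ t, g j (v j ω, t) ∂κ (v j ω)) * ∏ k ∈ K, κ (v k ω) (B k) ∂μ := by
  have hθ := h.measurable
  induction J using Finset.induction_on with
  | empty =>
    intro K _ C B hC hB
    simpa using h.cond_law K C B hC hB
  | insert i J hi ih =>
    intro K hK C B hC hB
    rw [Finset.disjoint_insert_left] at hK
    obtain ⟨hiK, hJK⟩ := hK
    set D : Set Ω := {ω | (fun j => v j ω) ∈ C ∧ ∀ k ∈ K, θ k ω ∈ B k} with hD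
    set D' : Set Ω := {ω | (fun j => v j ω) ∈ C} with hD'
    set W : Ω → ℝ≥0∞ := fun ω => ∏ j ∈ J, g j (v j ω, θ j ω) with hW
    set W' : Ω → ℝ≥0∞ := fun ω => (∏ j ∈ J, ∫⁻ t, g j (v j ω, t) ∂κ (v j ω)) *
      ∏ k ∈ K, κ (v k ω) (B k) with hW'
    have hWm : Measurable W := Finset.measurable_prod _ fun j _ =>
      (hg j).comp ((hv j).prodMk (hθ j))
    have hint : ∀ j, Measurable fun z => ∫⁻ t, g j (z, t) ∂κ z := fun j =>
      (hg j).lintegral_kernel_prod_right'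
    have hW'm : Measurable W' :=
      (Finset.measurable_prod _ fun j _ => (hint j).comp (hv j)).mul
        (Finset.measurable_prod _ fun k _ => (κ.measurable_coe (hB k)).comp (hv k))
    have hW1 : ∀ ω, W ω ≤ 1 := fun ω => Finset.prod_le_one' fun j _ => hg1 j _
    have hpair : Measurable fun ω => (v i ω, θ i ω) := (hv i).prodMk (hθ i)
    have : IsFiniteMeasure ((μ.restrict D).withDensity W) := by
      refine isFiniteMeasure_withDensity (ne_top_of_le_ne_top (measure_ne_top μ univ) ?_)
      calc ∫⁻ ω in D, W ω ∂μ ≤ ∫⁻ ω in D, 1 ∂μ := lintegral_mono hW1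
        _ ≤ μ univ := by simpa using measure_mono (subset_univ D)
    have hlint : ∫⁻ ω in D', W' ω ∂μ ≠ ∞ := by
      refine ne_top_of_le_ne_top (measure_ne_top μ univ) ?_
      calc ∫⁻ ω in D', W' ω ∂μ ≤ ∫⁻ ω in D', 1 ∂μ := by
            refine lintegral_mono fun ω => mul_le_one' (Finset.prod_le_one' fun j _ => ?_)
              (Finset.prod_le_one' fun k _ => prob_le_one)
            calc ∫⁻ t, g j (v j ω, t) ∂κ (v j ω) ≤ ∫⁻ t, 1 ∂κ (v j ω) :=
                  lintegral_mono fun t => hg1 j _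
              _ = 1 := by simp
        _ ≤ μ univ := by simpa using measure_mono (subset_univ D')
    have : IsFiniteMeasure ((μ.restrict D').withDensity W') := isFiniteMeasure_withDensity hlint
    -- Under the measure weighted by the other marks, `(v i, θ i)` is a draw from `κ` over its first
    -- coordinate. Both measures being finite, rectangles suffice.
    have key : ((μ.restrict D).withDensity W).map (fun ω => (v i ω, θ i ω)) =
        (((μ.restrict D').withDensity W').map (v i)).compProd κ := by
      refine Measure.ext_prod fun {A S} hA hS => ?_
      have hCA : MeasurableSet (C ∩ {x | x i ∈ A}) := hC.inter (measurable_pi_apply i hA)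
      have hBm : ∀ j, MeasurableSet (Function.update B i S j) := fun j => by
        by_cases hj : j = i
        · subst hj; simpa using hS
        · simpa [hj] using hB j
      -- The rectangle `A ×ˢ S` becomes an event: `A` is absorbed into `C`, and `S` becomes the test
      -- set of the new index `i` of `K`.
      have h1 := ih (insert i K) (Finset.disjoint_insert_right.2 ⟨hi, hJK⟩)
        (C ∩ {x | x i ∈ A}) (Function.update B i S) hCA hBm
      have hset : (fun ω => (v i ω, θ i ω)) ⁻¹' A ×ˢ S ∩ D =
          {ω | (fun j => v j ω) ∈ C ∩ {x | x i ∈ A} ∧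
            ∀ k ∈ insert i K, θ k ω ∈ Function.update B i S k} := by
        ext ω
        have : (∀ k ∈ K, θ k ω ∈ Function.update B i S k) ↔ ∀ k ∈ K, θ k ω ∈ B k :=
          forall₂_congr fun k hk => by
            rw [Function.update_of_ne (by rintro rfl; exact hiK hk)]
        simp only [hD, mem_inter_iff, mem_preimage, mem_prod, mem_ofPred_eq, Finset.forall_mem_insert,
          Function.update_self, this]
        tauto
      have hset' : v i ⁻¹' A ∩ D' = {ω | (fun j => v j ω) ∈ C ∩ {x | x i ∈ A}} := by
        ext ω
        simp only [hD', mem_inter_iff, mem_preimage, mem_ofPred_eq]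
        tauto
      rw [Measure.map_apply hpair (hA.prod hS), withDensity_apply _ (hpair (hA.prod hS)),
        Measure.restrict_restrict (hpair (hA.prod hS)), hset, h1, Measure.compProd_apply_prod hA hS,
        setLIntegral_map hA (κ.measurable_coe hS) (hv i), restrict_withDensity (hv i hA),
        lintegral_withDensity_eq_lintegral_mul _ hW'm
          (show Measurable fun ω => κ (v i ω) S from (κ.measurable_coe hS).comp (hv i)),
        Measure.restrict_restrict (hv i hA), hset']
      refine lintegral_congr fun ω => ?_
      have : ∏ k ∈ K, κ (v k ω) (Function.update B i S k) = ∏ k ∈ K, κ (v k ω) (B k) :=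
        Finset.prod_congr rfl fun k hk => by
          rw [Function.update_of_ne (by rintro rfl; exact hiK hk)]
      rw [Finset.prod_insert hiK, this, Function.update_self, Pi.mul_apply, hW']
      ring
    calc ∫⁻ ω in D, ∏ j ∈ insert i J, g j (v j ω, θ j ω) ∂μ
        = ∫⁻ ω in D, W ω * g i (v i ω, θ i ω) ∂μ := by
          refine lintegral_congr fun ω => ?_
          rw [Finset.prod_insert hi, mul_comm]
      _ = ∫⁻ x, g i x ∂((μ.restrict D).withDensity W).map (fun ω => (v i ω, θ i ω)) := by
          rw [lintegral_map (hg i) hpair,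
            lintegral_withDensity_eq_lintegral_mul _ hWm
              (show Measurable fun ω => g i (v i ω, θ i ω) from (hg i).comp hpair)]
          rfl
      _ = ∫⁻ ω in D', W' ω * ∫⁻ t, g i (v i ω, t) ∂κ (v i ω) ∂μ := by
          rw [key, Measure.lintegral_compProd (hg i), lintegral_map (hint i) (hv i),
            lintegral_withDensity_eq_lintegral_mul _ hW'm
              (show Measurable fun ω => ∫⁻ t, g i (v i ω, t) ∂κ (v i ω) from (hint i).comp (hv i))]
          rfl
      _ = _ := by
          refine lintegral_congr fun ω => ?_
          rw [Finset.prod_insert hi, hW']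
          ring

/-- Marks are integrated out point by point. -/
theorem IsIndependentMarking.lintegral_prod [IsFiniteMeasure μ] [IsMarkovKernel κ]
    (h : IsIndependentMarking v θ κ μ)
    (hv : ∀ j, Measurable (v j)) {g : E × M → ℝ≥0∞} (hg : Measurable g)
    (hg1 : ∀ x, g x ≤ 1) (J : Finset ℕ) :
    ∫⁻ ω, ∏ j ∈ J, g (v j ω, θ j ω) ∂μ =
      ∫⁻ ω, ∏ j ∈ J, ∫⁻ t, g (v j ω, t) ∂κ (v j ω) ∂μ := by
  have := h.setLIntegral_prod hv (fun _ => hg) (fun _ => hg1) J ∅ (Finset.disjoint_empty_right _)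
    univ (fun _ => univ) MeasurableSet.univ fun _ => MeasurableSet.univ
  simpa using this

end Marking

/-! ### The generating functional of a Poisson point process -/

/-- Take `f = -log Φ`, with value `∞` where `Φ` vanishes. This turns the Laplace functional into the
generating functional. -/
theorem exists_expNeg_eq {E : Type*} [MeasurableSpace E] {Φ : E → ℝ≥0∞} (hΦ : Measurable Φ)
    (hΦ1 : ∀ z, Φ z ≤ 1) : ∃ f : E → ℝ≥0∞, Measurable f ∧ ∀ z, expNeg (f z) = Φ z := by
  refine ⟨fun z => (-(ENNReal.log (Φ z))).toENNReal, ?_, fun z => ?_⟩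
  · exact EReal.continuous_toENNReal.measurable.comp (measurable_neg.comp (ENNReal.measurable_log.comp hΦ))
  · have : 0 ≤ -(ENNReal.log (Φ z)) := by
      rw [EReal.le_neg, neg_zero]
      exact ENNReal.log_le_zero_iff.2 (hΦ1 z)
    rw [expNeg, EReal.coe_toENNReal this, neg_neg, ENNReal.exp_log]

theorem IsPoissonPointProcess.tendsto_lintegral_prod {Ω E : Type*} [MeasurableSpace Ω]
    [MeasurableSpace E] {v : ℕ → Ω → E} {Λ : Measure E} {μ : Measure Ω} [SigmaFinite Λ]
    [IsProbabilityMeasure μ] (hv : IsPoissonPointProcess v Λ μ) {Φ : E → ℝ≥0∞} (hΦ : Measurable Φ)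
    (hΦ1 : ∀ z, Φ z ≤ 1) :
    Filter.Tendsto (fun N => ∫⁻ ω, ∏ j ∈ Finset.range N, Φ (v j ω) ∂μ) Filter.atTop
      (nhds (expNeg (∫⁻ z, (1 - Φ z) ∂Λ))) := by
  obtain ⟨f, hf, hfΦ⟩ := exists_expNeg_eq hΦ hΦ1
  simp only [← hfΦ]
  rw [← hv.lintegral_expNeg_tsum hf]
  exact tendsto_lintegral_prod_expNeg fun j => hf.comp (hv.measurable j)

/-! ### Exponential fading -/

/-- The product `exp (-x) exp (-c x)` is `1 / (1 + c)` times the exponential density of rate `1 +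
c`. -/
theorem lintegral_expNeg_expMeasure {c : ℝ} (hc : 0 ≤ c) :
    ∫⁻ x, expNeg (ENNReal.ofReal (c * x)) ∂expMeasure 1 = ENNReal.ofReal (1 / (1 + c)) := by
  have hm : Measurable (exponentialPDF 1) := (measurable_exponentialPDFReal 1).ennreal_ofReal
  have h1 : expMeasure 1 = volume.withDensity (exponentialPDF 1) := rfl
  have h2 : ∀ x, exponentialPDF 1 x * expNeg (ENNReal.ofReal (c * x)) =
      ENNReal.ofReal (1 / (1 + c)) * exponentialPDF (1 + c) x := fun x => by
    rcases lt_or_ge x 0 with hx | hx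
    · simp [exponentialPDF_of_neg hx]
    · rw [exponentialPDF_of_nonneg hx, exponentialPDF_of_nonneg hx,
        expNeg_ofReal (mul_nonneg hc hx), ← ENNReal.ofReal_mul (by positivity),
        ← ENNReal.ofReal_mul (by positivity), one_mul, ← exp_add, ← mul_assoc,
        one_div_mul_cancel (by positivity), one_mul, one_mul]
      congr 2; ring
  rw [h1, lintegral_withDensity_eq_lintegral_mul _ hm (by fun_prop)]
  simp only [Pi.mul_apply, h2]
  rw [lintegral_const_mul' _ _ ENNReal.ofReal_ne_top,
    lintegral_exponentialPDF_eq_one (by positivity), mul_one]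

theorem expMeasure_Ioi {y : ℝ} (hy : 0 ≤ y) : expMeasure 1 (Ioi y) = ENNReal.ofReal (exp (-y)) := by
  have := isProbabilityMeasure_expMeasure one_pos
  have h1 := cdf_expMeasure_eq one_pos y
  rw [if_pos hy, cdf_eq_real, one_mul] at h1
  rw [← compl_Iic, ← ofReal_measureReal (measure_ne_top _ _),
    probReal_compl_eq_one_sub measurableSet_Iic, h1]
  congr 1; ring

theorem expMeasure_setOf_lt_ofReal (t : ℝ≥0∞) :
    expMeasure 1 {x | t < ENNReal.ofReal x} = expNeg t := by
  by_cases ht : t = ∞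
  · simp [ht]
  · have : {x | t < ENNReal.ofReal x} = Ioi t.toReal := by
      ext x
      exact ENNReal.lt_ofReal_iff_toReal_lt ht
    rw [this, expMeasure_Ioi ENNReal.toReal_nonneg, expNeg_eq_ofReal ht]

section Fading

variable {Ω X : Type*} [MeasurableSpace Ω] [MeasurableSpace X] {μ : Measure Ω}
  [IsProbabilityMeasure μ]

/-- The probability that an exponential variable exceeds an independent one. -/
theorem measure_lt_exponential {h₀ : Ω → ℝ} {x : Ω → X} (hm₀ : Measurable h₀)
    (hm : Measurable x) (hlaw : HasLaw h₀ (expMeasure 1) μ) (hind : IndepFun h₀ x μ)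
    {Y : X → ℝ≥0∞} (hY : Measurable Y) :
    μ {ω | Y (x ω) < ENNReal.ofReal (h₀ ω)} = ∫⁻ ω, expNeg (Y (x ω)) ∂μ := by
  have hS : MeasurableSet {p : ℝ × X | Y p.2 < ENNReal.ofReal p.1} :=
    measurableSet_lt (by fun_prop) (by fun_prop)
  have hmap := (indepFun_iff_map_prod_eq_prod_map_map hm₀.aemeasurable hm.aemeasurable).1 hind
  have h1 : {ω | Y (x ω) < ENNReal.ofReal (h₀ ω)} =
      (fun ω => (h₀ ω, x ω)) ⁻¹' {p : ℝ × X | Y p.2 < ENNReal.ofReal p.1} := rfl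
  have := isProbabilityMeasure_expMeasure one_pos
  have := Measure.isProbabilityMeasure_map hm.aemeasurable (μ := μ)
  rw [h1, ← Measure.map_apply (hm₀.prodMk hm) hS, hmap, hlaw.map_eq, Measure.prod_apply_symm hS,
    lintegral_map (measurable_measure_prodMk_right hS) hm]
  exact lintegral_congr fun ω => expMeasure_setOf_lt_ofReal (Y (x ω))

/-- Exponential fading is integrated out. -/
theorem lintegral_prod_expNeg_fading {h : ℕ → Ω → ℝ} {x : Ω → X} (hm : ∀ j, Measurable (h j))
    (hx : Measurable x) (hlaw : ∀ j, HasLaw (h j) (expMeasure 1) μ) (hindep : iIndepFun h μ)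
    (hind : IndepFun (fun ω j => h j ω) x μ) {c : ℕ → X → ℝ} (hc : ∀ j, Measurable (c j))
    (hc0 : ∀ j y, 0 ≤ c j y) (J : Finset ℕ) :
    ∫⁻ ω, ∏ j ∈ J, expNeg (ENNReal.ofReal (c j (x ω) * h j ω)) ∂μ =
      ∫⁻ ω, ∏ j ∈ J, ENNReal.ofReal (1 / (1 + c j (x ω))) ∂μ := by
  have hH : Measurable fun ω j => h j ω := measurable_pi_lambda _ hm
  have hmap := (indepFun_iff_map_prod_eq_prod_map_map hH.aemeasurable hx.aemeasurable).1 hind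
  have hF : Measurable fun p : (ℕ → ℝ) × X =>
      ∏ j ∈ J, expNeg (ENNReal.ofReal (c j p.2 * p.1 j)) :=
    Finset.measurable_prod _ fun j _ => by fun_prop
  have hG : ∀ y, Measurable fun p : (ℕ → ℝ) =>
      ∏ j ∈ J, expNeg (ENNReal.ofReal (c j y * p j)) := fun y =>
    Finset.measurable_prod _ fun j _ => by fun_prop
  have := Measure.isProbabilityMeasure_map hH.aemeasurable (μ := μ)
  have := Measure.isProbabilityMeasure_map hx.aemeasurable (μ := μ)
  calc ∫⁻ ω, ∏ j ∈ J, expNeg (ENNReal.ofReal (c j (x ω) * h j ω)) ∂μ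
      = ∫⁻ p, ∏ j ∈ J, expNeg (ENNReal.ofReal (c j p.2 * p.1 j))
          ∂μ.map (fun ω => ((fun j => h j ω), x ω)) := (lintegral_map hF (hH.prodMk hx)).symm
    -- Independence makes the joint law a product, so `x` is frozen at `y` while the fading is
    -- averaged.
    _ = ∫⁻ y, ∫⁻ ω, ∏ j ∈ J, expNeg (ENNReal.ofReal (c j y * h j ω)) ∂μ ∂μ.map x := by
        rw [hmap, lintegral_prod_symm' _ hF]
        exact lintegral_congr fun y => lintegral_map (hG y) hH
    _ = ∫⁻ y, ∏ j ∈ J, ENNReal.ofReal (1 / (1 + c j y)) ∂μ.map x := by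
        refine lintegral_congr fun y => ?_
        have hi : iIndepFun (fun j ω => expNeg (ENNReal.ofReal (c j y * h j ω))) μ :=
          hindep.comp (fun j t => expNeg (ENNReal.ofReal (c j y * t))) fun j => by fun_prop
        rw [lintegral_prod_eq_prod_lintegral_of_indepFun J _ hi fun j => by
          have := hm j
          fun_prop]
        refine Finset.prod_congr rfl fun j _ => ?_
        rw [(hlaw j).lintegral_comp (f := fun t => expNeg (ENNReal.ofReal (c j y * t)))
          (Measurable.aemeasurable (by fun_prop)), lintegral_expNeg_expMeasure (hc0 j y)]
    _ = _ := lintegral_map (Finset.measurable_prod _ fun j _ => by fun_prop) hx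

end Fading

end IoTUplink

/-! ### The success probability as a Laplace transform -/

namespace IoTUplink

theorem measurableSet_norm_le (a : ℝ) : MeasurableSet {z : ℂ | ‖z‖ ≤ a} :=
  measurableSet_le measurable_norm measurable_const

theorem measurableSet_le_norm (a : ℝ) : MeasurableSet {z : ℂ | a ≤ ‖z‖} :=
  measurableSet_le measurable_const measurable_norm

open Classical in
/-- The law of the orientation as a kernel. -/
noncomputable def orientationKernel (R : ℝ) : Kernel ℂ ℝ :=
  Kernel.piecewise (measurableSet_norm_le (√3 * R))
    (Kernel.const ℂ (cond volume (Icc (π / 2) (3 * π / 2))))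
    (Kernel.const ℂ (cond volume (Icc 0 (2 * π))))

/-- This supplies the measurability in the location that the marking lemmas require. -/
theorem coe_orientationKernel (R : ℝ) : ⇑(orientationKernel R) = orientationLaw R := by
  ext1 z
  simp [orientationKernel, orientationLaw, Kernel.piecewise_apply]

theorem isProbabilityMeasure_cond_Icc {α β : ℝ} (h : α < β) :
    IsProbabilityMeasure (cond (volume : Measure ℝ) (Icc α β)) :=
  cond_isProbabilityMeasure_of_finite (by simpa using h) (by simp)

instance (R : ℝ) : IsMarkovKernel (orientationKernel R) where
  isProbabilityMeasure z := by
    rw [coe_orientationKernel, orientationLaw]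
    split_ifs
    · exact isProbabilityMeasure_cond_Icc (by linarith [pi_pos])
    · exact isProbabilityMeasure_cond_Icc (by linarith [pi_pos])

theorem gain_nonneg {b : ℝ} (hb₀ : 0 ≤ b) (hb₁ : b ≤ 1) (n : ℕ) (θ : ℝ) : 0 ≤ gain b n θ := by
  have := neg_one_le_cos (n * θ)
  rw [gain]
  nlinarith

@[fun_prop]
theorem continuous_gain (b : ℝ) (n : ℕ) : Continuous (gain b n) := by
  unfold gain; fun_prop

@[fun_prop]
theorem measurable_gain (b : ℝ) (n : ℕ) : Measurable (gain b n) := (continuous_gain b n).measurable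

theorem gain_zero (b : ℝ) (n : ℕ) : gain b n 0 = 1 + b := by simp [gain]

theorem periodic_gain (b : ℝ) (n : ℕ) : Function.Periodic (gain b n) (2 * π) := fun θ => by
  rw [gain, gain, mul_add, cos_add_nat_mul_two_pi]

/-- The mean received power, relative to that of the intended link and scaled by `T`, of a device at
`z` with orientation `t`; it vanishes for devices that do not interfere. -/
noncomputable def relPower (T η R b : ℝ) (n : ℕ) (φ₀ : ℝ) (z : ℂ) (t : ℝ) : ℝ :=
  {z : ℂ | √3 * R / 2 ≤ ‖z‖}.indicator
    (fun z => T * gain b n t * gain b n (z.arg - φ₀) * ‖z‖ ^ (-η)) z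

theorem relPower_nonneg {T b : ℝ} (hT : 0 ≤ T) (hb₀ : 0 ≤ b) (hb₁ : b ≤ 1) (η R : ℝ) (n : ℕ)
    (φ₀ : ℝ) (z : ℂ) (t : ℝ) : 0 ≤ relPower T η R b n φ₀ z t := by
  refine indicator_nonneg (fun z _ => ?_) z
  have h1 := gain_nonneg hb₀ hb₁ n t
  have h2 := gain_nonneg hb₀ hb₁ n (z.arg - φ₀)
  positivity

theorem measurable_relPower (T η R b : ℝ) (n : ℕ) (φ₀ : ℝ) :
    Measurable fun p : ℂ × ℝ => relPower T η R b n φ₀ p.1 p.2 := by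
  have h : (fun p : ℂ × ℝ => relPower T η R b n φ₀ p.1 p.2) =
      {p : ℂ × ℝ | √3 * R / 2 ≤ ‖p.1‖}.indicator
        (fun p => T * gain b n p.2 * gain b n (p.1.arg - φ₀) * ‖p.1‖ ^ (-η)) := by
    ext p
    simp only [relPower, indicator_apply]
    rfl
  rw [h]
  refine Measurable.indicator ?_ (measurable_fst (measurableSet_le_norm _))
  have : Measurable Complex.arg := Complex.measurable_arg
  fun_prop

/-- The exclusion zone is moved into `relPower`, so a silent device contributes the neutral factor
`exp 0 = 1`. -/
theorem ofReal_mul_interference {Ω : Type*} {v : ℕ → Ω → ℂ} {θ h : ℕ → Ω → ℝ} {s : ℝ}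
    (hs : 0 ≤ s) (P η R b : ℝ) (n : ℕ) (φ₀ : ℝ) (ω : Ω) :
    ENNReal.ofReal s * interference P η R b n φ₀ v θ h ω =
      ∑' j, ENNReal.ofReal (relPower (s * P) η R b n φ₀ (v j ω) (θ j ω) * h j ω) := by
  rw [interference, ← ENNReal.tsum_mul_left]
  refine tsum_congr fun j => ?_
  by_cases hz : v j ω ∈ {z : ℂ | √3 * R / 2 ≤ ‖z‖}
  · rw [relPower, indicator_of_mem hz, indicator_of_mem hz, ← ENNReal.ofReal_mul hs]
    congr 1; ring
  · rw [relPower, indicator_of_notMem hz, indicator_of_notMem hz]; simp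

section Laplace

variable {Ω : Type*} [MeasurableSpace Ω] {μ : Measure Ω} {lam R : ℝ}
  {v : ℕ → Ω → ℂ} {θ h : ℕ → Ω → ℝ} {h₀ : Ω → ℝ}

theorem measurable_interference (P η R b : ℝ) (n : ℕ) (φ₀ : ℝ) (hv : ∀ j, Measurable (v j))
    (hθ : ∀ j, Measurable (θ j)) (hh : ∀ j, Measurable (h j)) :
    Measurable (interference P η R b n φ₀ v θ h) := by
  refine Measurable.tsum fun j => ?_
  have h1 : (fun ω => {z : ℂ | √3 * R / 2 ≤ ‖z‖}.indicator
      (fun z => ENNReal.ofReal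
        (P * h j ω * gain b n (θ j ω) * gain b n (z.arg - φ₀) * ‖z‖ ^ (-η))) (v j ω)) =
      (v j ⁻¹' {z : ℂ | √3 * R / 2 ≤ ‖z‖}).indicator (fun ω => ENNReal.ofReal
        (P * h j ω * gain b n (θ j ω) * gain b n ((v j ω).arg - φ₀) * ‖v j ω‖ ^ (-η))) := by
    ext ω
    simp only [indicator_apply]
    rfl
  rw [h1]
  refine Measurable.indicator ?_ (hv j (measurableSet_le_norm _))
  have : Measurable Complex.arg := Complex.measurable_arg
  have := hv j
  have := hθ j
  have := hh j
  fun_prop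

/-- The Laplace transform of the interference. -/
theorem IsPoissonModel.lintegral_expNeg_interference [IsProbabilityMeasure μ]
    (hmodel : IsPoissonModel μ lam R v θ h h₀) {s P η b φ₀ : ℝ} {n : ℕ} (hs : 0 ≤ s) (hP : 0 ≤ P)
    (hb₀ : 0 ≤ b) (hb₁ : b ≤ 1) :
    ∫⁻ ω, expNeg (ENNReal.ofReal s * interference P η R b n φ₀ v θ h ω) ∂μ =
      expNeg (ENNReal.ofReal lam * ∫⁻ z, ∫⁻ t, ENNReal.ofReal
        (relPower (s * P) η R b n φ₀ z t / (1 + relPower (s * P) η R b n φ₀ z t))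
          ∂orientationLaw R z) := by
  have hv := hmodel.locations.measurable
  have hθ := hmodel.orientations.measurable
  have hh := hmodel.measurable_fading
  have hqm := measurable_relPower (s * P) η R b n φ₀
  have hq0 := relPower_nonneg (mul_nonneg hs hP) hb₀ hb₁ η R n φ₀
  simp only [ofReal_mul_interference hs]
  -- Only measurability and nonnegativity of the relative power matter from here on.
  generalize relPower (s * P) η R b n φ₀ = q at hqm hq0 ⊢
  have hV : Measurable fun ω => ((fun j => v j ω : ℕ → ℂ), (fun j => θ j ω : ℕ → ℝ)) :=
    (measurable_pi_lambda _ hv).prodMk (measurable_pi_lambda _ hθ)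
  have hqj : ∀ j, Measurable fun ω => q (v j ω) (θ j ω) := fun j =>
    hqm.comp ((hv j).prodMk (hθ j))
  set g : ℂ × ℝ → ℝ≥0∞ := fun p => ENNReal.ofReal (1 / (1 + q p.1 p.2)) with hg
  have hgm : Measurable g := by fun_prop
  have hg1 : ∀ p, g p ≤ 1 := fun p => by
    rw [hg, ENNReal.ofReal_le_one, div_le_one (by linarith [hq0 p.1 p.2])]
    linarith [hq0 p.1 p.2]
  set κ := orientationKernel R with hκ
  have hmark : IsIndependentMarking v θ κ μ := by
    rw [hκ, coe_orientationKernel]; exact hmodel.orientations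
  set Φ : ℂ → ℝ≥0∞ := fun z => ∫⁻ t, g (z, t) ∂κ z with hΦ
  have hΦm : Measurable Φ := hgm.lintegral_kernel_prod_right'
  have hΦ1 : ∀ z, Φ z ≤ 1 := fun z => by
    calc Φ z ≤ ∫⁻ t, 1 ∂κ z := lintegral_mono fun t => hg1 _
      _ = 1 := by simp
  have hfin : ∀ N, ∫⁻ ω, ∏ j ∈ Finset.range N,
      expNeg (ENNReal.ofReal (q (v j ω) (θ j ω) * h j ω)) ∂μ =
      ∫⁻ ω, ∏ j ∈ Finset.range N, Φ (v j ω) ∂μ := fun N => by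
    have h1 := lintegral_prod_expNeg_fading hh hV hmodel.law_fading hmodel.indep_fading
      hmodel.indep_fading_devices (c := fun j x => q (x.1 j) (x.2 j))
      (fun j => hqm.comp (f := fun x : (ℕ → ℂ) × (ℕ → ℝ) => (x.1 j, x.2 j)) (by fun_prop))
      (fun j x => hq0 _ _) (Finset.range N)
    exact h1.trans (hmark.lintegral_prod hv hgm hg1 _)
  have hlim := tendsto_lintegral_prod_expNeg (μ := μ)
    (f := fun j ω => ENNReal.ofReal (q (v j ω) (θ j ω) * h j ω)) fun j => by
      have := hqj j
      have := hh j
      fun_prop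
  simp only [hfin] at hlim
  have : IsLocallyFiniteMeasure (ENNReal.ofReal lam • (volume : Measure ℂ)) :=
    inferInstanceAs (IsLocallyFiniteMeasure (lam.toNNReal • (volume : Measure ℂ)))
  have hlim' := hmodel.locations.tendsto_lintegral_prod hΦm hΦ1
  -- The same finite products tend both to the Laplace transform and to the Poisson generating
  -- functional.
  rw [tendsto_nhds_unique hlim hlim', lintegral_smul_measure, smul_eq_mul]
  congr 2
  refine lintegral_congr fun z => ?_
  rw [← coe_orientationKernel, ← hκ]
  have h2 : ∀ t, ENNReal.ofReal (q z t / (1 + q z t)) = 1 - g (z, t) := fun t => by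
    have := hq0 z t
    rw [hg, ← ENNReal.ofReal_one, ← ENNReal.ofReal_sub _ (by positivity)]
    congr 1
    field_simp
    ring
  simp only [h2]
  rw [lintegral_sub (show Measurable fun t => g (z, t) from hgm.comp measurable_prodMk_left)
    (ne_top_of_le_ne_top ENNReal.one_ne_top (hΦ1 z)) (Filter.Eventually.of_forall fun t => hg1 _)]
  simp [hΦ]

/-- The success probability in terms of the Laplace transform of the interference. -/
theorem IsPoissonModel.measure_lt_sinr [IsProbabilityMeasure μ]
    (hmodel : IsPoissonModel μ lam R v θ h h₀) {Ξ P σ η b φ₀ r₀ : ℝ} {n : ℕ} (hΞ : 0 < Ξ)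
    (hP : 0 < P) (hb₀ : 0 ≤ b) (hr₀ : 0 < r₀) :
    μ {ω | ENNReal.ofReal Ξ < sinr P σ η R b n φ₀ r₀ v θ h h₀ ω} =
      expNeg (ENNReal.ofReal (Ξ * r₀ ^ η * σ ^ 2 / (gain b n 0 * gain b n 0 * P))) *
        ∫⁻ ω, expNeg (ENNReal.ofReal (Ξ * r₀ ^ η / (gain b n 0 * gain b n 0 * P)) *
          interference P η R b n φ₀ v θ h ω) ∂μ := by
  have hv := hmodel.locations.measurable
  have hθ := hmodel.orientations.measurable
  have hh := hmodel.measurable_fading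
  have hg : 0 < gain b n 0 := by rw [gain_zero]; linarith
  set g := gain b n 0 with hgdef
  set s : ℝ := Ξ * r₀ ^ η / (g * g * P) with hs
  have hs0 : 0 ≤ s := by positivity
  have hk : 0 < P * g * g * r₀ ^ (-η) := by positivity
  have hsk : Ξ = s * (P * g * g * r₀ ^ (-η)) := by
    rw [hs, rpow_neg hr₀.le]
    have : r₀ ^ η ≠ 0 := by positivity
    field_simp
  -- Clearing the denominator in `[0, ∞]` is safe: a zero denominator is covered by `Ξ` being
  -- finite, infinite interference by `Ξ` being nonzero.
  have hev : ∀ ω, ENNReal.ofReal Ξ < sinr P σ η R b n φ₀ r₀ v θ h h₀ ω ↔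
      ENNReal.ofReal s * (ENNReal.ofReal (σ ^ 2) + interference P η R b n φ₀ v θ h ω) <
        ENNReal.ofReal (h₀ ω) := fun ω => by
    have h1 : P * h₀ ω * g * g * r₀ ^ (-η) = P * g * g * r₀ ^ (-η) * h₀ ω := by ring
    rw [sinr, ENNReal.lt_div_iff_mul_lt (Or.inr ENNReal.ofReal_ne_top)
      (Or.inr (by simpa using hΞ)), ← hgdef, h1, ENNReal.ofReal_mul hk.le, hsk, mul_comm s,
      ENNReal.ofReal_mul hk.le, mul_assoc]
    exact ENNReal.mul_lt_mul_iff_right (by simpa using hk) ENNReal.ofReal_ne_top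
  let x : Ω → (ℕ → ℝ) × (ℕ → ℂ) × (ℕ → ℝ) := fun ω =>
    ((fun j => h j ω : ℕ → ℝ), (fun j => v j ω : ℕ → ℂ), (fun j => θ j ω : ℕ → ℝ))
  have hx : Measurable x := (measurable_pi_lambda _ hh).prodMk
    ((measurable_pi_lambda _ hv).prodMk (measurable_pi_lambda _ hθ))
  -- The interference is rebuilt from coordinate projections on sequence space, making it a
  -- measurable function of the variable `x` independent of `h₀`.
  let Y : (ℕ → ℝ) × (ℕ → ℂ) × (ℕ → ℝ) → ℝ≥0∞ := fun p => ENNReal.ofReal s *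
    (ENNReal.ofReal (σ ^ 2) + interference P η R b n φ₀ (fun j p => p.2.1 j) (fun j p => p.2.2 j)
      (fun j p => p.1 j) p)
  have hY : Measurable Y := by
    refine Measurable.const_mul (Measurable.const_add ?_ _) _
    exact measurable_interference P η R b n φ₀ (fun j => by fun_prop) (fun j => by fun_prop)
      (fun j => by fun_prop)
  have h3 := measure_lt_exponential hmodel.measurable_fading₀ hx hmodel.law_fading₀
    hmodel.indep_fading₀ hY
  simp only [hev]
  refine h3.trans ?_
  have h4 : ∀ ω, expNeg (Y (x ω)) = expNeg (ENNReal.ofReal (Ξ * r₀ ^ η * σ ^ 2 / (g * g * P))) *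
      expNeg (ENNReal.ofReal s * interference P η R b n φ₀ v θ h ω) := fun ω => by
    have h5 : Y (x ω) = ENNReal.ofReal s *
      (ENNReal.ofReal (σ ^ 2) + interference P η R b n φ₀ v θ h ω) := rfl
    rw [h5, mul_add, expNeg_add, ← ENNReal.ofReal_mul hs0]
    congr 3
    rw [hs]; ring
  simp only [h4]
  exact lintegral_const_mul _ (measurable_expNeg.comp
    ((measurable_interference P η R b n φ₀ hv hθ hh).const_mul _))

end Laplace

end IoTUplink

/-! ### Integration over the plane -/

namespace IoTUplink

/-- The radial integral `∫_{r > a} r c r^(-η) / (1 + c r^(-η)) dr` in closed form. -/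
noncomputable def radialMean (η a c : ℝ) : ℝ := c * a ^ (2 - η) / (η - 2) * hyp η (-c / a ^ η)

theorem continuous_radialMean_comp {X : Type*} [TopologicalSpace X] {η a : ℝ} (hη : 2 < η)
    (ha : 0 < a) {c : X → ℝ} (hc : Continuous c) (hc0 : ∀ x, 0 ≤ c x) :
    Continuous fun x => radialMean η a (c x) := by
  have h1 : Continuous fun x => hyp η (-c x / a ^ η) :=
    (continuousOn_hyp hη).comp_continuous (by fun_prop) fun x => by
      have : -c x / a ^ η ≤ 0 :=
        div_nonpos_of_nonpos_of_nonneg (by linarith [hc0 x]) (by positivity)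
      exact lt_of_le_of_lt this one_pos
  unfold radialMean
  fun_prop

theorem radial_nonneg {η c r : ℝ} (hc : 0 ≤ c) (hr : 0 ≤ r) :
    0 ≤ r * (c * r ^ (-η) / (1 + c * r ^ (-η))) := by positivity

theorem lintegral_radial_Ioi {η a c : ℝ} (hη : 2 < η) (ha : 0 < a) (hc : 0 ≤ c) :
    ∫⁻ r in Ioi a, ENNReal.ofReal (r * (c * r ^ (-η) / (1 + c * r ^ (-η)))) =
      ENNReal.ofReal (radialMean η a c) := by
  rw [radialMean, ← integral_radial hη ha hc]
  refine (ofReal_integral_eq_lintegral_ofReal (integrableOn_radial hη ha hc) ?_).symm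
  filter_upwards [ae_restrict_mem measurableSet_Ioi] with r hr
  exact radial_nonneg hc (ha.trans hr).le

theorem radialMean_nonneg {η a c : ℝ} (hη : 2 < η) (ha : 0 < a) (hc : 0 ≤ c) :
    0 ≤ radialMean η a c := by
  rw [radialMean, ← integral_radial hη ha hc]
  exact setIntegral_nonneg measurableSet_Ioi fun r hr => radial_nonneg hc (ha.trans hr).le

theorem lintegral_radial_Icc {η a a' c : ℝ} (hη : 2 < η) (ha : 0 < a) (haa' : a ≤ a')
    (hc : 0 ≤ c) :
    ∫⁻ r in Icc a a', ENNReal.ofReal (r * (c * r ^ (-η) / (1 + c * r ^ (-η)))) =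
      ENNReal.ofReal (radialMean η a c - radialMean η a' c) := by
  have ha' := ha.trans_le haa'
  have h1 := lintegral_radial_Ioi hη ha hc
  rw [← Ioc_union_Ioi_eq_Ioi haa', lintegral_union measurableSet_Ioi
    (disjoint_left.2 fun x hx hx' => not_lt.2 hx.2 hx'), lintegral_radial_Ioi hη ha' hc,
    setLIntegral_congr Ioc_ae_eq_Icc] at h1
  rw [ENNReal.ofReal_sub _ (radialMean_nonneg hη ha' hc), ← h1,
    ENNReal.add_sub_cancel_right ENNReal.ofReal_ne_top]

/-- The closed form hides this monotonicity; the tail integral of a nonnegative function shows it.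
-/
theorem radialMean_antitone {η a a' c : ℝ} (hη : 2 < η) (ha : 0 < a) (haa' : a ≤ a')
    (hc : 0 ≤ c) : radialMean η a' c ≤ radialMean η a c := by
  have h1 := lintegral_radial_Ioi hη ha hc
  have h2 := lintegral_radial_Ioi hη (ha.trans_le haa') hc
  rw [← ENNReal.ofReal_le_ofReal_iff (radialMean_nonneg hη ha hc), ← h1, ← h2]
  exact lintegral_mono_set (Ioi_subset_Ioi haa')

theorem setLIntegral_Icc_ofReal {α β : ℝ} (hαβ : α ≤ β) {k : ℝ → ℝ} (hk : Continuous k)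
    (hk0 : ∀ t, 0 ≤ k t) :
    ∫⁻ t in Icc α β, ENNReal.ofReal (k t) = ENNReal.ofReal (∫ t in α..β, k t) := by
  rw [intervalIntegral.integral_of_le hαβ, ← integral_Icc_eq_integral_Ioc]
  exact (ofReal_integral_eq_lintegral_ofReal (hk.integrableOn_Icc)
    (Filter.Eventually.of_forall hk0)).symm

theorem lintegral_cond_Icc_ofReal {α β : ℝ} (hαβ : α < β) {k : ℝ → ℝ} (hk : Continuous k)
    (hk0 : ∀ t, 0 ≤ k t) :
    ∫⁻ t, ENNReal.ofReal (k t) ∂cond volume (Icc α β) =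
      ENNReal.ofReal ((β - α)⁻¹ * ∫ t in α..β, k t) := by
  rw [ProbabilityTheory.cond, lintegral_smul_measure, setLIntegral_Icc_ofReal hαβ.le hk hk0, smul_eq_mul,
    Real.volume_Icc, ← ENNReal.ofReal_inv_of_pos (sub_pos.2 hαβ),
    ← ENNReal.ofReal_mul (inv_nonneg.2 (sub_pos.2 hαβ).le)]

/-- By Tonelli the radius is integrated first, at fixed orientation. The set `s` stands for the ring
or the exterior, and `k` for its radial integral. -/
theorem lintegral_lintegral_radial {η c₀ : ℝ} {b : ℝ} {n : ℕ} (hb₀ : 0 ≤ b) (hb₁ : b ≤ 1)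
    (hc₀ : 0 ≤ c₀) {α β : ℝ} (hαβ : α < β) {s : Set ℝ} {k : ℝ → ℝ}
    (hk : Continuous fun t => k (c₀ * gain b n t)) (hk0 : ∀ c, 0 ≤ c → 0 ≤ k c)
    (hs : ∀ c, 0 ≤ c →
      ∫⁻ r in s, ENNReal.ofReal (r * (c * r ^ (-η) / (1 + c * r ^ (-η)))) = ENNReal.ofReal (k c)) :
    ∫⁻ r in s, ∫⁻ t, ENNReal.ofReal (r * (c₀ * gain b n t * r ^ (-η) /
        (1 + c₀ * gain b n t * r ^ (-η)))) ∂cond volume (Icc α β) =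
      ENNReal.ofReal ((β - α)⁻¹ * ∫ t in α..β, k (c₀ * gain b n t)) := by
  have := isProbabilityMeasure_cond_Icc hαβ
  have hc : ∀ t, 0 ≤ c₀ * gain b n t := fun t => mul_nonneg hc₀ (gain_nonneg hb₀ hb₁ n t)
  rw [lintegral_lintegral_swap (Measurable.aemeasurable (by unfold Function.uncurry; fun_prop))]
  simp only [hs _ (hc _)]
  exact lintegral_cond_Icc_ofReal hαβ hk fun t => hk0 _ (hc t)

/-- The mean over the orientation and the distance of the loss caused by a device seen under the
angle `ψ` relative to the direction of the gateway antenna. -/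
noncomputable def angularMean (T η R b : ℝ) (n : ℕ) (ψ : ℝ) : ℝ :=
  (π)⁻¹ * (∫ t in (π / 2)..(3 * π / 2), (radialMean η (√3 * R / 2) (T * gain b n ψ * gain b n t) -
      radialMean η (√3 * R) (T * gain b n ψ * gain b n t))) +
    (2 * π)⁻¹ * ∫ t in (0)..(2 * π), radialMean η (√3 * R) (T * gain b n ψ * gain b n t)

section Plane

variable {T η R b : ℝ} {n : ℕ}

theorem continuous_radialMean_gain (hη : 2 < η) (hT : 0 ≤ T) (hb₀ : 0 ≤ b) (hb₁ : b ≤ 1) {a : ℝ}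
    (ha : 0 < a) :
    Continuous fun p : ℝ × ℝ => radialMean η a (T * gain b n p.1 * gain b n p.2) :=
  continuous_radialMean_comp hη ha (by fun_prop) fun p =>
    mul_nonneg (mul_nonneg hT (gain_nonneg hb₀ hb₁ n _)) (gain_nonneg hb₀ hb₁ n _)

theorem continuous_angularMean (hη : 2 < η) (hR : 0 < R) (hT : 0 ≤ T) (hb₀ : 0 ≤ b)
    (hb₁ : b ≤ 1) : Continuous (angularMean T η R b n) := by
  have h1 := continuous_radialMean_gain (n := n) hη hT hb₀ hb₁ (a := √3 * R) (by positivity)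
  have h2 := continuous_radialMean_gain (n := n) hη hT hb₀ hb₁ (a := √3 * R / 2) (by positivity)
  refine ((intervalIntegral.continuous_parametric_intervalIntegral_of_continuous'
    (h2.sub h1) _ _).const_mul _).add
    ((intervalIntegral.continuous_parametric_intervalIntegral_of_continuous' h1 _ _).const_mul _)

theorem periodic_angularMean : Function.Periodic (angularMean T η R b n) (2 * π) := fun ψ => by
  simp only [angularMean, periodic_gain b n ψ]

theorem angularMean_nonneg (hη : 2 < η) (hR : 0 < R) (hT : 0 ≤ T) (hb₀ : 0 ≤ b)
    (hb₁ : b ≤ 1) (ψ : ℝ) : 0 ≤ angularMean T η R b n ψ := by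
  have hπ := pi_pos
  have hA : 0 < √3 * R := by positivity
  have hc : ∀ t, 0 ≤ T * gain b n ψ * gain b n t := fun t =>
    mul_nonneg (mul_nonneg hT (gain_nonneg hb₀ hb₁ n _)) (gain_nonneg hb₀ hb₁ n _)
  refine add_nonneg (mul_nonneg (by positivity) (intervalIntegral.integral_nonneg (by linarith)
    fun t _ => sub_nonneg.2 ?_)) (mul_nonneg (by positivity)
    (intervalIntegral.integral_nonneg (by linarith) fun t _ => ?_))
  · exact radialMean_antitone hη (by positivity) (by linarith) (hc t)
  · exact radialMean_nonneg hη hA (hc t)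

/-- The integral over the distance, for a fixed direction `ψ`. -/
theorem lintegral_radius (hη : 2 < η) (hR : 0 < R) (hT : 0 ≤ T) (hb₀ : 0 ≤ b) (hb₁ : b ≤ 1)
    (φ₀ : ℝ) {φ : ℝ} (hφ : φ ∈ Ioo (-π) π) :
    ∫⁻ r in Ioi (0 : ℝ), ENNReal.ofReal r * ∫⁻ t, ENNReal.ofReal
        (relPower T η R b n φ₀ (Complex.polarCoord.symm (r, φ)) t /
          (1 + relPower T η R b n φ₀ (Complex.polarCoord.symm (r, φ)) t))
        ∂orientationLaw R (Complex.polarCoord.symm (r, φ)) =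
      ENNReal.ofReal (angularMean T η R b n (φ - φ₀)) := by
  have hπ := pi_pos
  have hA : 0 < √3 * R := by positivity
  have hA2 : 0 < √3 * R / 2 := by positivity
  have hc₀ : 0 ≤ T * gain b n (φ - φ₀) := mul_nonneg hT (gain_nonneg hb₀ hb₁ n _)
  set c₀ := T * gain b n (φ - φ₀) with hc₀def
  have hc : ∀ t, 0 ≤ c₀ * gain b n t := fun t => mul_nonneg hc₀ (gain_nonneg hb₀ hb₁ n _)
  set I : ℝ → Measure ℝ → ℝ≥0∞ := fun r ν => ∫⁻ t, ENNReal.ofReal (r * (c₀ * gain b n t * r ^ (-η) /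
        (1 + c₀ * gain b n t * r ^ (-η)))) ∂ν with hI
  have hp1 := isProbabilityMeasure_cond_Icc (α := π / 2) (β := 3 * π / 2) (by linarith)
  have hp2 := isProbabilityMeasure_cond_Icc (α := 0) (β := 2 * π) (by linarith)
  have hIm : ∀ ν : Measure ℝ, IsProbabilityMeasure ν → Measurable fun r => I r ν := fun ν _ => by
    refine Measurable.lintegral_prod_right' (f := fun p : ℝ × ℝ => ENNReal.ofReal
      (p.1 * (c₀ * gain b n p.2 * p.1 ^ (-η) / (1 + c₀ * gain b n p.2 * p.1 ^ (-η))))) ?_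
    fun_prop
  -- Three zones: no loss below `√3 R / 2`, the half-circle law on the ring, the full-circle law
  -- beyond. The Jacobian `r` is absorbed into the integrand.
  have hpt : ∀ r ∈ Ioi (0 : ℝ), ENNReal.ofReal r * ∫⁻ t, ENNReal.ofReal
        (relPower T η R b n φ₀ (Complex.polarCoord.symm (r, φ)) t /
          (1 + relPower T η R b n φ₀ (Complex.polarCoord.symm (r, φ)) t))
        ∂orientationLaw R (Complex.polarCoord.symm (r, φ)) =
      (Icc (√3 * R / 2) (√3 * R)).indicator
        (fun r => I r (cond volume (Icc (π / 2) (3 * π / 2)))) r +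
      (Ioi (√3 * R)).indicator (fun r => I r (cond volume (Icc 0 (2 * π)))) r := by
    intro r hr
    have hr0 : 0 < r := hr
    have hnorm : ‖Complex.polarCoord.symm (r, φ)‖ = r := by
      rw [Complex.norm_polarCoord_symm, abs_of_pos hr0]
    have harg : (Complex.polarCoord.symm (r, φ)).arg = φ := by
      rw [Complex.polarCoord_symm_apply]
      push_cast
      exact Complex.arg_mul_cos_add_sin_mul_I hr0 ⟨hφ.1, hφ.2.le⟩
    have hrel : ∀ t, relPower T η R b n φ₀ (Complex.polarCoord.symm (r, φ)) t =
        if √3 * R / 2 ≤ r then c₀ * gain b n t * r ^ (-η) else 0 := fun t => by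
      simp only [relPower, indicator_apply, mem_ofPred_eq, hnorm, harg, hc₀def]
      split_ifs
      · ring
      · rfl
    rcases lt_or_ge r (√3 * R / 2) with h1 | h1
    · have e1 : r ∉ Icc (√3 * R / 2) (√3 * R) := fun h => not_le.2 h1 h.1
      have e2 : r ∉ Ioi (√3 * R) := fun h => by
        have : √3 * R < r := h
        linarith
      rw [indicator_of_notMem e1, indicator_of_notMem e2]
      simp only [hrel, if_neg (not_le.2 h1)]
      simp
    · simp only [hrel, if_pos h1, orientationLaw, hnorm]
      rw [← lintegral_const_mul' _ _ ENNReal.ofReal_ne_top]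
      simp only [← ENNReal.ofReal_mul hr0.le]
      by_cases h2 : r ≤ √3 * R
      · have e1 : r ∈ Icc (√3 * R / 2) (√3 * R) := ⟨h1, h2⟩
        have e2 : r ∉ Ioi (√3 * R) := not_lt.2 h2
        rw [indicator_of_mem e1, indicator_of_notMem e2, if_pos h2, add_zero]
      · have e1 : r ∉ Icc (√3 * R / 2) (√3 * R) := fun h => h2 h.2
        have e2 : r ∈ Ioi (√3 * R) := not_le.1 h2
        rw [indicator_of_notMem e1, indicator_of_mem e2, if_neg h2, zero_add]
  have s1 : Icc (√3 * R / 2) (√3 * R) ∩ Ioi 0 = Icc (√3 * R / 2) (√3 * R) :=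
    inter_eq_left.2 fun r hr => hA2.trans_le hr.1
  have s2 : Ioi (√3 * R) ∩ Ioi 0 = Ioi (√3 * R) := inter_eq_left.2 (Ioi_subset_Ioi hA.le)
  have k1 : Continuous fun t => radialMean η (√3 * R) (c₀ * gain b n t) :=
    continuous_radialMean_comp hη hA (by fun_prop) hc
  have k2 : Continuous fun t => radialMean η (√3 * R / 2) (c₀ * gain b n t) :=
    continuous_radialMean_comp hη hA2 (by fun_prop) hc
  rw [setLIntegral_congr_fun measurableSet_Ioi hpt,
    lintegral_add_left ((hIm _ hp1).indicator measurableSet_Icc),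
    lintegral_indicator measurableSet_Icc, lintegral_indicator measurableSet_Ioi,
    Measure.restrict_restrict measurableSet_Icc, Measure.restrict_restrict measurableSet_Ioi,
    s1, s2, hI,
    lintegral_lintegral_radial hb₀ hb₁ hc₀ (by linarith)
      (k := fun c => radialMean η (√3 * R / 2) c - radialMean η (√3 * R) c) (k2.sub k1)
      (fun c hc => sub_nonneg.2 (radialMean_antitone hη hA2 (by linarith) hc))
      (fun c hc => lintegral_radial_Icc hη hA2 (by linarith) hc),
    lintegral_lintegral_radial hb₀ hb₁ hc₀ (by linarith) k1
      (fun c hc => radialMean_nonneg hη hA hc) (fun c hc => lintegral_radial_Ioi hη hA hc),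
    ← ENNReal.ofReal_add, angularMean]
  · congr 3
    · ring
    · ring
  · refine mul_nonneg (by rw [inv_nonneg]; linarith)
      (intervalIntegral.integral_nonneg (by linarith) fun t _ => sub_nonneg.2 ?_)
    exact radialMean_antitone hη hA2 (by linarith) (hc t)
  · refine mul_nonneg (by rw [inv_nonneg]; linarith)
      (intervalIntegral.integral_nonneg (by linarith) fun t _ => ?_)
    exact radialMean_nonneg hη hA (hc t)

theorem lintegral_plane (hη : 2 < η) (hR : 0 < R) (hT : 0 ≤ T) (hb₀ : 0 ≤ b) (hb₁ : b ≤ 1)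
    (φ₀ : ℝ) :
    ∫⁻ z, ∫⁻ t, ENNReal.ofReal (relPower T η R b n φ₀ z t / (1 + relPower T η R b n φ₀ z t))
        ∂orientationLaw R z =
      ENNReal.ofReal (∫ ψ in (0)..(2 * π), angularMean T η R b n ψ) := by
  have hπ := pi_pos
  have hq := measurable_relPower T η R b n φ₀
  have hm : Measurable fun z => ∫⁻ t, ENNReal.ofReal
      (relPower T η R b n φ₀ z t / (1 + relPower T η R b n φ₀ z t)) ∂orientationLaw R z := by
    rw [← coe_orientationKernel]
    refine Measurable.lintegral_kernel_prod_right' (κ := orientationKernel R)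
      (f := fun p : ℂ × ℝ => ENNReal.ofReal
        (relPower T η R b n φ₀ p.1 p.2 / (1 + relPower T η R b n φ₀ p.1 p.2))) ?_
    fun_prop
  have hsymm : Measurable fun p : ℝ × ℝ => Complex.polarCoord.symm p := by
    simp only [Complex.polarCoord_symm_apply]
    fun_prop
  have hcont := continuous_angularMean (n := n) hη hR hT hb₀ hb₁
  rw [← Complex.lintegral_comp_polarCoord_symm, polarCoord_target, Measure.volume_eq_prod,
    ← Measure.prod_restrict]
  simp only [smul_eq_mul]
  rw [lintegral_prod_symm' _ (by have := hm.comp hsymm; exact (by fun_prop : Measurable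
      fun p : ℝ × ℝ => ENNReal.ofReal p.1).mul this),
    setLIntegral_congr_fun measurableSet_Ioo fun φ hφ => lintegral_radius hη hR hT hb₀ hb₁ φ₀ hφ,
    setLIntegral_congr Ioo_ae_eq_Icc,
    setLIntegral_Icc_ofReal (by linarith) (by fun_prop)
      fun φ => angularMean_nonneg hη hR hT hb₀ hb₁ _,
    intervalIntegral.integral_comp_sub_right]
  -- The angle `φ - φ₀` runs over one full period starting at `-π - φ₀`, so the starting point is
  -- immaterial.
  have h1 := (periodic_angularMean (T := T) (η := η) (R := R) (b := b) (n := n)).intervalIntegral_add_eq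
    (-π - φ₀) 0
  rw [zero_add] at h1
  rw [← h1]
  congr 2
  ring

end Plane

end IoTUplink

/-! ### The closed form -/

namespace IoTUplink

theorem sinrThreshold_pos {ζ W L Ts : ℝ} {m : ℕ} (hL : 0 < L) (hTs : 0 < Ts) (hζ : 0 < ζ)
    (hW : 0 < W) (hm : 0 < m) : 0 < sinrThreshold ζ W (txRate L m Ts) := by
  have hm' : (0 : ℝ) < m := Nat.cast_pos.2 hm
  exact sub_pos.2 (one_lt_rpow one_lt_two (by unfold txRate; positivity))

/-- This is the source of the constants `2^η` and `4` in the ring term. -/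
theorem div_two_rpow_two_sub {a : ℝ} (ha : 0 < a) (η : ℝ) :
    (a / 2) ^ (2 - η) = a ^ (2 - η) * 2 ^ η / 4 := by
  rw [div_rpow ha.le zero_le_two, rpow_sub two_pos, rpow_two]
  have : (2 : ℝ) ^ η ≠ 0 := by positivity
  field_simp
  norm_num

/-- With the common factor `k`, the exterior has weight `(2π)⁻¹ · k/2` and the ring `π⁻¹ · k/4`.
Both equal `k / (4π)`, the prefactor of the bracket. -/
theorem activeDensity_mul_angularMean {Ξ g₀ P η R b r₀ Δx Δy : ℝ} {n NG : ℕ} (hη : 2 < η)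
    (hR : 0 < R) (hP : 0 < P) (hg₀ : 0 < g₀) (hΔx : 0 < Δx) (hΔy : 0 < Δy) (hNG : 0 < NG)
    (ψ : ℝ) :
    activeDensity Δx Δy NG * angularMean (Ξ * r₀ ^ η / (g₀ * P) * P) η R b n ψ =
      Ξ * r₀ ^ η * gain b n ψ * (√3 * R) ^ (2 - η) /
          (4 * g₀ * π * (η - 2) * Δx * Δy * NG) *
        ((∫ θ₂ in (0)..(2 * π), 2 * gain b n θ₂ *
            hyp η (-(Ξ * r₀ ^ η * gain b n θ₂ * gain b n ψ) / (g₀ * (√3 * R) ^ η))) +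
          ∫ θ₂ in (π / 2)..(3 * π / 2), gain b n θ₂ *
            (2 ^ η * hyp η
                (-(Ξ * r₀ ^ η * gain b n θ₂ * gain b n ψ) / (g₀ * (√3 * R / 2) ^ η)) -
              4 * hyp η
                (-(Ξ * r₀ ^ η * gain b n θ₂ * gain b n ψ) / (g₀ * (√3 * R) ^ η)))) := by
  have hA : 0 < √3 * R := by positivity
  have hη2 : η - 2 ≠ 0 := by linarith
  have hNG' : (NG : ℝ) ≠ 0 := by positivity
  have hT : Ξ * r₀ ^ η / (g₀ * P) * P = Ξ * r₀ ^ η / g₀ := by field_simp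
  set T := Ξ * r₀ ^ η / g₀ with hTdef
  set k : ℝ := T * gain b n ψ * (√3 * R) ^ (2 - η) / (η - 2) with hk
  have harg : ∀ t a : ℝ, -(T * gain b n ψ * gain b n t) / a ^ η =
      -(Ξ * r₀ ^ η * gain b n t * gain b n ψ) / (g₀ * a ^ η) := fun t a => by
    rw [hTdef, ← div_div]; congr 1; field_simp
  have e1 : ∀ t, radialMean η (√3 * R) (T * gain b n ψ * gain b n t) =
      k / 2 * (2 * gain b n t *
        hyp η (-(Ξ * r₀ ^ η * gain b n t * gain b n ψ) / (g₀ * (√3 * R) ^ η))) := fun t => by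
    rw [radialMean, harg, hk]; ring
  have e2 : ∀ t, radialMean η (√3 * R / 2) (T * gain b n ψ * gain b n t) -
      radialMean η (√3 * R) (T * gain b n ψ * gain b n t) =
      k / 4 * (gain b n t * (2 ^ η * hyp η
                (-(Ξ * r₀ ^ η * gain b n t * gain b n ψ) / (g₀ * (√3 * R / 2) ^ η)) -
              4 * hyp η
                (-(Ξ * r₀ ^ η * gain b n t * gain b n ψ) / (g₀ * (√3 * R) ^ η)))) := fun t => by
    rw [radialMean, radialMean, harg, harg, hk, div_two_rpow_two_sub hA]; ring
  rw [hT, angularMean]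
  -- The ring term goes first: `e1` would rewrite inside the left side of `e2`.
  simp only [e2]
  simp only [e1]
  rw [intervalIntegral.integral_const_mul, intervalIntegral.integral_const_mul, hk, hTdef,
    activeDensity]
  field_simp
  ring

theorem IsPoissonModel.successProb_eq {Ω : Type*} [MeasurableSpace Ω] {μ : Measure Ω}
    [IsProbabilityMeasure μ] {Δx Δy R : ℝ} {NG : ℕ} {v : ℕ → Ω → ℂ} {θ h : ℕ → Ω → ℝ} {h₀ : Ω → ℝ}
    (hmodel : IsPoissonModel μ (activeDensity Δx Δy NG) R v θ h h₀)
    (hΔx : 0 < Δx) (hΔy : 0 < Δy) (hR : 0 < R) (hNG : 0 < NG)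
    {Ξ η b P σ r₀ φ₀ : ℝ} {n : ℕ} (hΞ : 0 < Ξ) (hη : 2 < η) (hb₀ : 0 ≤ b) (hb₁ : b ≤ 1)
    (hP : 0 < P) (hr₀ : 0 < r₀) :
    successProb μ Ξ P σ η R b n φ₀ r₀ v θ h h₀ =
      successFormula (gain b n 0 * gain b n 0) Ξ P σ η R b n r₀ Δx Δy NG := by
  have hg : 0 < gain b n 0 := by rw [gain_zero]; linarith
  have hs : 0 ≤ Ξ * r₀ ^ η / (gain b n 0 * gain b n 0 * P) := by positivity
  have hlam : 0 ≤ activeDensity Δx Δy NG := by unfold activeDensity; positivity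
  have hI : 0 ≤ ∫ ψ in (0)..(2 * π),
      angularMean (Ξ * r₀ ^ η / (gain b n 0 * gain b n 0 * P) * P) η R b n ψ :=
    intervalIntegral.integral_nonneg (by positivity) fun ψ _ =>
      angularMean_nonneg hη hR (mul_nonneg hs hP.le) hb₀ hb₁ ψ
  rw [successProb, measureReal_def, hmodel.measure_lt_sinr hΞ hP hb₀ hr₀,
    hmodel.lintegral_expNeg_interference hs hP.le hb₀ hb₁,
    lintegral_plane hη hR (mul_nonneg hs hP.le) hb₀ hb₁, ← ENNReal.ofReal_mul hlam,
    ← expNeg_add, ← ENNReal.ofReal_add (by positivity) (mul_nonneg hlam hI),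
    expNeg_ofReal (add_nonneg (by positivity) (mul_nonneg hlam hI)),
    ENNReal.toReal_ofReal (exp_pos _).le, successFormula, neg_add',
    ← intervalIntegral.integral_const_mul]
  simp only [activeDensity_mul_angularMean hη hR hP (mul_pos hg hg) hΔx hΔy hNG]

end IoTUplink

theorem theorem2 {Ω : Type*} [MeasurableSpace Ω] (μ : MeasureTheory.Measure Ω)
    [MeasureTheory.IsProbabilityMeasure μ]
    -- geometry of the network
    (Δx Δy R : ℝ) (NG : ℕ) (hΔx : 0 < Δx) (hΔy : 0 < Δy) (hR : 0 < R) (hNG : 0 < NG)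
    -- path loss, antennas, transmit power, noise, position of the intended device
    (η b : ℝ) (n : ℕ) (P σ r₀ φ₀ : ℝ) (hη : 2 < η) (hb₀ : 0 ≤ b) (hb₁ : b ≤ 1)
    (hP : 0 < P) (hr₀ : 0 < r₀)
    -- segmentation and rate
    (L Ts ζ W : ℝ) (m : ℕ) (hL : 0 < L) (hTs : 0 < Ts) (hζ : 0 < ζ) (hW : 0 < W) (hm : 0 < m)
    -- locations, orientations and fading gains
    (v : ℕ → Ω → ℂ) (θ h : ℕ → Ω → ℝ) (h₀ : Ω → ℝ)
    (hmodel : IoTUplink.IsPoissonModel μ (IoTUplink.activeDensity Δx Δy NG) R v θ h h₀) :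
    IoTUplink.successProb μ (IoTUplink.sinrThreshold ζ W (IoTUplink.txRate L m Ts))
        P σ η R b n φ₀ r₀ v θ h h₀ =
      IoTUplink.successFormula (IoTUplink.gain b n 0 * IoTUplink.gain b n 0)
        (IoTUplink.sinrThreshold ζ W (IoTUplink.txRate L m Ts)) P σ η R b n r₀ Δx Δy NG ∧
    (b = 1 →
      IoTUplink.successProb μ (IoTUplink.sinrThreshold ζ W (IoTUplink.txRate L m Ts))
          P σ η R b n φ₀ r₀ v θ h h₀ =
        IoTUplink.successFormula 4
          (IoTUplink.sinrThreshold ζ W (IoTUplink.txRate L m Ts)) P σ η R b n r₀ Δx Δy NG) := by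
  have hmain := hmodel.successProb_eq (σ := σ) (φ₀ := φ₀) (n := n) hΔx hΔy hR hNG
    (IoTUplink.sinrThreshold_pos hL hTs hζ hW hm) hη hb₀ hb₁ hP hr₀
  refine ⟨hmain, fun hb => ?_⟩
  have hg : IoTUplink.gain b n 0 * IoTUplink.gain b n 0 = 4 := by
    rw [IoTUplink.gain_zero, hb]; norm_num
  rw [hmain, hg]
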